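/- **Conventions.** Let $\pi\colon V\to M$ be a smooth vector bundle of finite rank over an $n$-dimensional smooth manifold $M$, let $\mathcal E\subset J^k(\pi)$ be a differential equation with prolongations $\mathcal E^s\subset J^{k+s}(\pi)$, $s\ge 0$ ($\mathcal E^0=\mathcal E$), and infinite prolongation $\mathcal E^\infty\subset J^\infty(\pi)$. Assume that $\mathcal E$ is formally integrable: all $\mathcal E^s$ are smooth submanifolds, $\pi_{\mathcal E}\colon\mathcal E^\infty\to M$ is a smooth bundle, and $\mathcal E^\infty\to\mathcal E^s$ is onto for every $s$. Write $D(X)$ for the vector fields on $X$, and let $\mathcal C_{\mathcal E}\colon D(M)\to D(\mathcal E^\infty)$ be the Cartan connection (restriction of total derivatives to $\mathcal E^\infty$). Manifolds and fibres of bundles may have finite or (countably) infinite dimension; on infinite-dimensional ones smooth functions depend locally on finitely many coordinates. Let $\rho\colon X\to M$ carry a flat connection $\mathcal C_X\colon D(M)\to D(X)$, i.e. a $C^\infty(M)$-linear map with $\rho_*\circ\mathcal C_X=\mathrm{id}$ that preserves commutators, and let $\mathcal CD(X)\subset D(X)$ be the $C^\infty(X)$-module generated by its image. * A *covering* over $X$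 is a smooth locally trivial fibre bundle $\tau\colon W\to X$ together with a flat connection $\mathcal C_W\colon D(M)\to D(W)$ for $\rho\circ\tau$ such that $\tau_*\circ\mathcal C_W=\mathcal C_X$. * $T^v\rho\to X$ denotes the bundle of $\rho$-vertical tangent vectors, with projection $\rho^v$. It is a covering over $X$: the lift of $Y\in D(M)$ is the vector field on $T^v\rho$ that maps (the pullback of) $f\in C^\infty(X)$ to (the pullback of) $\mathcal C_X(Y)(f)$ and the fibrewise linear function $df$ to $d(\mathcal C_X(Y)(f))$. * A *symmetry* of $X$ is a $\rho$-vertical field $S\in D(X)$ with $[S,\mathcal CD(X)]\subset\mathcal CD(X)$; it is identified with the corresponding section $X\to T^v\rho$. If $X=W$ is the total space of a covering $\tau\colon W\to\mathcal E^\infty$, this is called a *nonlocal $\tau$-symmetry*. * For a covering $\tau\colon W\to\mathcal E^\infty$, a *$\tau$-shadow* is a smooth map $s\colon W\to T^v\pi_{\mathcal E}$ such that $\pi_{\mathcal E}^v\circ s=\tau$ and $s_*$ takes the Cartan distribution of $W$ to that of $T^v\pi_{\mathcal E}$. **Proposition (shadow reconstruction theorem).** For every covering $\tau\colon W\to\mathcal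 E^\infty$ and every $\tau$-shadow $s\colon W\to T^v\pi_{\mathcal E}$ there exist a covering $\tau'\colon W'\to W$ such that $\tau\circ\tau'\colon W'\to\mathcal E^\infty$ is a covering as well, and a nonlocal $\tau\circ\tau'$-symmetry $s'\colon W'\to T^v(\pi_{\mathcal E}\circ\tau\circ\tau')$, such that $$(\tau\circ\tau')_*\circ s'=s\circ\tau',\qquad (\pi_{\mathcal E}\circ\tau\circ\tau')^v\circ s'=\mathrm{id}_{W'} ,$$ and $s'_*$ takes the Cartan distribution of $W'$ to that of $T^v(\pi_{\mathcal E}\circ\tau\circ\tau')$. -/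

import Mathlib

open scoped Manifold ContDiff Topology
open Set Filter

universe u v w

noncomputable section

namespace PDEGeom

/-! ### Differential spaces: sets with an algebra of smooth functions -/

/-- The weakest topology on `X` making all functions in `S` continuous. -/
@[reducible] def initialTop {X : Type u} (S : Set (X → ℝ)) : TopologicalSpace X :=
  TopologicalSpace.induced (fun x (s : S) => s.1 x) inferInstance

theorem initialTop_continuous {X : Type u} {S : Set (X → ℝ)} {f : X → ℝ} (hf : f ∈ S) :
    @Continuous _ _ (initialTop S) _ f := by
  let _ := initialTop S
  have h : Continuous fun (x : X) (s : S) => s.1 x := continuous_induced_dom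
  exact continuous_pi_iff.1 h ⟨f, hf⟩

theorem continuous_initialTop {Y : Type v} [TopologicalSpace Y] {X : Type u} {S : Set (X → ℝ)}
    {g : Y → X} (h : ∀ f ∈ S, Continuous (f ∘ g)) : @Continuous _ _ _ (initialTop S) g := by
  let _ := initialTop S
  exact continuous_induced_rng.2 (continuous_pi fun s => h s.1 s.2)

/-- A differential space in the sense of Sikorski: a set with a family of functions, called smooth,
that is closed under composition with smooth functions of finitely many real variables and contains
every function which agrees locally with members of the family. The topology is the weakest one
making all smooth functions continuous. Finite-dimensional manifolds, manifolds modelled on `ℝ^∞`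
(such as spaces of infinite jets, where a smooth function depends locally on finitely many
coordinates), and their subsets are all of this kind. -/
structure DiffSpace where
  carrier : Type u
  smooth : Set (carrier → ℝ)
  comp_mem : ∀ {κ : Type} [Fintype κ] (φ : (κ → ℝ) → ℝ), ContDiff ℝ ∞ φ →
    ∀ f : κ → carrier → ℝ, (∀ i, f i ∈ smooth) → (fun y => φ fun i => f i y) ∈ smooth
  local_mem : ∀ g : carrier → ℝ,
    (∀ x, ∃ f ∈ smooth, g =ᶠ[@nhds _ (initialTop smooth) x] f) → g ∈ smooth

instance : CoeSort DiffSpace.{u} (Type u) := ⟨DiffSpace.carrier⟩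

instance (X : DiffSpace.{u}) : TopologicalSpace X := initialTop X.smooth

/-- Functions that are, locally, smooth functions of finitely many members of `S`. -/
def genSet {X : Type u} (S : Set (X → ℝ)) : Set (X → ℝ) :=
  {g | ∀ x, ∃ (κ : Type) (_ : Fintype κ) (φ : (κ → ℝ) → ℝ) (t : κ → X → ℝ),
    ContDiff ℝ ∞ φ ∧ (∀ i, t i ∈ S) ∧ g =ᶠ[@nhds _ (initialTop S) x] fun y => φ fun i => t i y}

theorem subset_genSet {X : Type u} (S : Set (X → ℝ)) : S ⊆ genSet S := fun f hf x =>
  ⟨Unit, inferInstance, fun v => v (), fun _ => f, contDiff_apply ℝ ℝ (), fun _ => hf,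
    Filter.EventuallyEq.rfl⟩

theorem initialTop_genSet {X : Type u} (S : Set (X → ℝ)) :
    initialTop (genSet S) = initialTop S := by
  apply le_antisymm
  · rw [← continuous_id_iff_le]
    let _ := initialTop (genSet S)
    exact continuous_initialTop fun f hf => initialTop_continuous (subset_genSet S hf)
  · rw [← continuous_id_iff_le]
    let _ := initialTop S
    refine continuous_initialTop fun f hf => ?_
    rw [continuous_iff_continuousAt]
    intro x
    obtain ⟨κ, _, φ, t, hφ, ht, h⟩ := hf x
    refine ContinuousAt.congr ?_ h.symm
    exact (hφ.continuous.comp (continuous_pi fun i => initialTop_continuous (ht i))).continuousAt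

/-- The differential space on `X` generated by `S`. -/
def DiffSpace.generate (X : Type u) (S : Set (X → ℝ)) : DiffSpace.{u} where
  carrier := X
  smooth := genSet S
  comp_mem := by
    intro κ _ φ hφ f hf x
    choose ι hι ψ t hψ ht h using fun i => hf i x
    let _ := hι
    refine ⟨Σ i, ι i, inferInstance, fun v => φ fun i => ψ i fun j => v ⟨i, j⟩,
      fun p => t p.1 p.2, ?_, fun p => ht p.1 p.2, ?_⟩
    · exact hφ.comp (contDiff_pi.2 fun i => (hψ i).comp
        (contDiff_pi.2 fun j => contDiff_apply ℝ ℝ _))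
    · filter_upwards [eventually_all.2 h] with y hy
      simp only [hy]
  local_mem := by
    intro g hg x
    obtain ⟨f, hf, h⟩ := hg x
    rw [initialTop_genSet] at h
    obtain ⟨κ, i, φ, t, hφ, ht, h'⟩ := hf x
    exact ⟨κ, i, φ, t, hφ, ht, h.trans h'⟩

namespace DiffSpace

/-- The algebra `C^∞(X)` of smooth functions. -/
def SmoothFun (X : DiffSpace.{u}) : Subalgebra ℝ (X → ℝ) where
  carrier := X.smooth
  mul_mem' {a b} ha hb := X.comp_mem (κ := Fin 2) (fun v => v 0 * v 1)
    ((contDiff_apply ℝ ℝ _).mul (contDiff_apply ℝ ℝ _)) ![a, b] (by simp [Fin.forall_fin_two, ha, hb])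
  add_mem' {a b} ha hb := X.comp_mem (κ := Fin 2) (fun v => v 0 + v 1)
    ((contDiff_apply ℝ ℝ _).add (contDiff_apply ℝ ℝ _)) ![a, b] (by simp [Fin.forall_fin_two, ha, hb])
  algebraMap_mem' r := X.comp_mem (κ := Empty) (fun _ => r) contDiff_const (fun i => i.elim)
    (fun i => i.elim)

instance (X : DiffSpace.{u}) : CoeFun (SmoothFun X) (fun _ => X → ℝ) := ⟨Subtype.val⟩

theorem smoothFun_continuous {X : DiffSpace.{u}} (f : SmoothFun X) : Continuous f.1 := initialTop_continuous f.2

/-- Vector fields on `X`: derivations of the algebra `C^∞(X)`. -/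
abbrev VectorField (X : DiffSpace.{u}) := Derivation ℝ (SmoothFun X) (SmoothFun X)

end DiffSpace

open DiffSpace

/-- Smooth maps: those which pull smooth functions back to smooth functions. -/
@[ext]
structure SMap (X : DiffSpace.{u}) (Y : DiffSpace.{v}) where
  toFun : X → Y
  smooth' : ∀ g ∈ Y.smooth, g ∘ toFun ∈ X.smooth

instance (X : DiffSpace.{u}) (Y : DiffSpace.{v}) : CoeFun (SMap X Y) (fun _ => X → Y) :=
  ⟨SMap.toFun⟩

namespace SMap

theorem continuous {X : DiffSpace.{u}} {Y : DiffSpace.{v}} (F : SMap X Y) : Continuous F.toFun :=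
  continuous_initialTop fun f hf => initialTop_continuous (F.smooth' f hf)

/-- The homomorphism `F^* : C^∞(Y) → C^∞(X)`, `g ↦ g ∘ F`. -/
def pull {X : DiffSpace.{u}} {Y : DiffSpace.{v}} (F : SMap X Y) : SmoothFun Y →ₐ[ℝ] SmoothFun X where
  toFun g := ⟨g.1 ∘ F.toFun, F.smooth' g.1 g.2⟩
  map_one' := rfl
  map_mul' _ _ := rfl
  map_zero' := rfl
  map_add' _ _ := rfl
  commutes' _ := rfl

/-- Composition `G ∘ F`. -/
def comp {X : DiffSpace.{u}} {Y : DiffSpace.{v}} {Z : DiffSpace.{w}} (G : SMap Y Z) (F : SMap X Y) :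
    SMap X Z where
  toFun := G.toFun ∘ F.toFun
  smooth' g hg := F.smooth' _ (G.smooth' g hg)

/-- A map into a generated space is smooth if it pulls generators back to smooth functions. -/
def intoGenerate {X : DiffSpace.{u}} {Y : Type v} {S : Set (Y → ℝ)} (F : X → Y)
    (h : ∀ g ∈ S, g ∘ F ∈ X.smooth) : SMap X (generate Y S) where
  toFun := F
  smooth' g hg := by
    apply X.local_mem
    intro x
    obtain ⟨κ, _, φ, t, hφ, ht, e⟩ := hg (F x)
    refine ⟨_, X.comp_mem φ hφ (fun i => t i ∘ F) fun i => h _ (ht i), ?_⟩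
    have hc : @Continuous _ _ _ (initialTop S) F := by
      apply continuous_initialTop
      exact fun f hf => initialTop_continuous (h f hf)
    let _ := initialTop S
    exact hc.continuousAt.eventually e

end SMap

theorem exists_bump {X : Type u} {S : Set (X → ℝ)} {x : X} {U : Set X}
    (hU : U ∈ @nhds _ (initialTop S) x) :
    ∃ (κ : Type) (_ : Fintype κ) (φ : (κ → ℝ) → ℝ) (t : κ → X → ℝ), ContDiff ℝ ∞ φ ∧
      (∀ i, t i ∈ S) ∧ (φ fun i => t i x) = 1 ∧ ∀ y ∉ U, (φ fun i => t i y) = 0 := by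
  rw [initialTop, nhds_induced, nhds_pi, mem_comap] at hU
  obtain ⟨V, hV, hVU⟩ := hU
  obtain ⟨I, T, hT, hI⟩ := mem_pi'.1 hV
  let c : Fin I.card → ℝ := fun i => (I.equivFin.symm i).1.1 x
  have hn : {v : Fin I.card → ℝ | ∀ i, v i ∈ T (I.equivFin.symm i).1} ∈ 𝓝 c :=
    eventually_all.2 fun i => (continuous_apply i).continuousAt.eventually (hT _)
  obtain ⟨ε, hε, hb⟩ := Metric.mem_nhds_iff.1 hn
  let b : ContDiffBump c := ⟨ε / 2, ε, by positivity, by linarith⟩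
  refine ⟨Fin I.card, inferInstance, b, fun i => (I.equivFin.symm i).1.1, b.contDiff,
    fun i => (I.equivFin.symm i).1.2, b.one_of_mem_closedBall (by simp [b, c]; positivity), fun y hy => ?_⟩
  by_contra hne
  apply hy
  apply hVU
  apply hI
  intro s hs
  have hm : (fun i => (I.equivFin.symm i).1.1 y) ∈ Metric.ball c ε := by
    have := b.support_eq
    rw [← show b.rOut = ε from rfl, ← this]
    exact hne
  have := hb hm (I.equivFin ⟨s, hs⟩)
  simpa using this

theorem smooth_parametric {κ : Type} [Fintype κ] (n : ℕ) : ∀ {G : Type} [NormedAddCommGroup G]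
    [NormedSpace ℝ G] [CompleteSpace G] (f : (κ → ℝ) × ℝ → G), ContDiff ℝ ∞ f →
    ContDiff ℝ n (fun y => ∫ s in (0:ℝ)..1, f (y, s)) := by
  induction n with
  | zero =>
    intro G _ _ _ f hf
    rw [Nat.cast_zero, contDiff_zero]
    exact intervalIntegral.continuous_parametric_intervalIntegral_of_continuous' 
      (by simpa [Function.uncurry_def] using hf.continuous) 0 1
  | succ n ih =>
    intro G _ _ _ f hf
    let f' : (κ → ℝ) × ℝ → ((κ → ℝ) →L[ℝ] G) := fun p => (fderiv ℝ f p).comp (.inl ℝ _ _)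
    have hf' : ContDiff ℝ ∞ f' :=
      (hf.fderiv_right (m := ∞) (by simp)).clm_comp contDiff_const
    have hd : ∀ y, HasFDerivAt (fun y => ∫ s in (0:ℝ)..1, f (y, s))
        (∫ s in (0:ℝ)..1, f' (y, s)) y := by
      intro y
      have hk : IsCompact (Metric.closedBall y 1 ×ˢ Icc (0:ℝ) 1) :=
        (isCompact_closedBall y 1).prod isCompact_Icc
      obtain ⟨B, hB⟩ := hk.exists_bound_of_continuousOn hf'.continuous.continuousOn
      refine (intervalIntegral.hasFDerivAt_integral_of_dominated_of_fderiv_le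
        (μ := MeasureTheory.volume) (s := Metric.ball y 1) (bound := fun _ => B) (F' := fun y s => f' (y, s)) 
        (Metric.ball_mem_nhds y one_pos) ?_ ?_ ?_ ?_ ?_ ?_)
      · exact Eventually.of_forall fun z =>
          (hf.continuous.comp (by fun_prop : Continuous fun s : ℝ => (z, s))).aestronglyMeasurable
      · exact (hf.continuous.comp (by fun_prop : Continuous fun s : ℝ => (y, s))).intervalIntegrable 0 1
      · exact (hf'.continuous.comp (by fun_prop : Continuous fun s : ℝ => (y, s))).aestronglyMeasurable
      · refine Eventually.of_forall fun s hs z hz => hB (z, s) ⟨Metric.ball_subset_closedBall hz, ?_⟩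
        rw [uIoc_of_le zero_le_one] at hs
        exact Ioc_subset_Icc_self hs
      · exact intervalIntegrable_const
      · refine Eventually.of_forall fun s hs z hz => ?_
        have h1 := (hf.differentiable (by simp) (z, s)).hasFDerivAt
        exact h1.comp z (hasFDerivAt_prodMk_left z s)
    push_cast
    rw [contDiff_succ_iff_fderiv]
    refine ⟨fun y => (hd y).differentiableAt, by simp, ?_⟩
    rw [show fderiv ℝ (fun y => ∫ s in (0:ℝ)..1, f (y, s)) = fun y => ∫ s in (0:ℝ)..1, f' (y, s)
      from funext fun y => (hd y).fderiv]
    exact ih f' hf'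

theorem hadamard_lemma {κ : Type} [Fintype κ] [DecidableEq κ] (φ : (κ → ℝ) → ℝ) (hφ : ContDiff ℝ ∞ φ)
    (c : κ → ℝ) : ∃ ψ : κ → (κ → ℝ) → ℝ, (∀ i, ContDiff ℝ ∞ (ψ i)) ∧
      (∀ i, ψ i c = fderiv ℝ φ c (Pi.single i 1)) ∧
      ∀ v, φ v = φ c + ∑ i, (v i - c i) * ψ i v := by
  refine ⟨fun i v => ∫ s in (0:ℝ)..1, fderiv ℝ φ (c + s • (v - c)) (Pi.single i 1), fun i => ?_,
    fun i => by simp, fun v => ?_⟩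
  · rw [contDiff_infty]
    intro n
    refine smooth_parametric n (fun p => fderiv ℝ φ (c + p.2 • (p.1 - c)) (Pi.single i 1)) ?_
    exact ((hφ.fderiv_right (m := ∞) (by simp)).comp (by fun_prop)).clm_apply contDiff_const
  · have hc : Continuous fun s : ℝ => fderiv ℝ φ (c + s • (v - c)) :=
      (hφ.continuous_fderiv (by simp)).comp (by fun_prop)
    have hd : ∀ s : ℝ, HasDerivAt (fun s : ℝ => φ (c + s • (v - c)))
        (fderiv ℝ φ (c + s • (v - c)) (v - c)) s := by
      intro s
      have h1 := (hφ.differentiable (by simp) (c + s • (v - c))).hasFDerivAt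
      have h2 : HasDerivAt (fun s : ℝ => c + s • (v - c)) (v - c) s := by
        simpa using ((hasDerivAt_id s).smul_const (v - c)).const_add c
      exact h1.comp_hasDerivAt s h2
    have := intervalIntegral.integral_eq_sub_of_hasDerivAt (fun s _ => hd s)
      ((hc.clm_apply continuous_const).intervalIntegrable 0 1)
    simp only [one_smul, add_sub_cancel, zero_smul, add_zero] at this
    rw [eq_add_of_sub_eq' this.symm]
    congr 1
    have hs : ∀ s : ℝ, fderiv ℝ φ (c + s • (v - c)) (v - c) =
        ∑ i, (v i - c i) * fderiv ℝ φ (c + s • (v - c)) (Pi.single i 1) := by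
      intro s
      have h3 := congrArg (fderiv ℝ φ (c + s • (v - c))) (Finset.univ_sum_single (v - c))
      rw [← h3, map_sum]
      refine Finset.sum_congr rfl fun i _ => ?_
      rw [← smul_eq_mul, ← map_smul, ← Pi.single_smul]
      simp
    simp only [hs]
    rw [intervalIntegral.integral_finsetSum]
    · simp
    · intro i _
      exact (continuous_const.mul (hc.clm_apply continuous_const)).intervalIntegrable 0 1

theorem exists_smooth_bump {X : DiffSpace.{u}} {x : X} {U : Set X} (hU : U ∈ 𝓝 x) :
    ∃ b : SmoothFun X, b x = 1 ∧ ∀ y ∉ U, b y = 0 := by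
  obtain ⟨κ, _, φ, t, hφ, ht, h1, h0⟩ := exists_bump hU
  exact ⟨⟨_, X.comp_mem φ hφ t ht⟩, h1, h0⟩

theorem derivation_local {X : DiffSpace.{u}} (Z : VectorField X) {f g : SmoothFun X} {x : X} (h : f.1 =ᶠ[𝓝 x] g.1) :
    Z f x = Z g x := by
  obtain ⟨b, h1, h0⟩ := exists_smooth_bump h
  have hz : b * (f - g) = 0 := by
    ext y
    by_cases hy : f.1 y = g.1 y
    · simp [hy]
    · simp [h0 y hy]
  have h2 := congrArg (fun k : SmoothFun X => k x) (congrArg Z hz)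
  have h3 : f.1 x = g.1 x := h.self_of_nhds
  simp only [Derivation.leibniz, map_sub, map_zero] at h2
  simp [h1, h3] at h2
  linarith

/-- The chain rule for vector fields. -/
theorem derivation_chain {X : DiffSpace.{u}} (Z : VectorField X) {κ : Type} [Fintype κ] [DecidableEq κ]
    (φ : (κ → ℝ) → ℝ) (hφ : ContDiff ℝ ∞ φ) (t : κ → SmoothFun X) (g : SmoothFun X) (x : X)
    (hg : g.1 =ᶠ[𝓝 x] fun y => φ fun i => t i y) :
    Z g x = ∑ i, fderiv ℝ φ (fun i => t i x) (Pi.single i 1) * Z (t i) x := by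
  obtain ⟨ψ, hψ, hψc, h⟩ := hadamard_lemma φ hφ (fun i => t i x)
  let P : κ → SmoothFun X := fun i => ⟨_, X.comp_mem (ψ i) (hψ i) (fun j => (t j).1) fun j => (t j).2⟩
  let k : SmoothFun X := algebraMap ℝ (SmoothFun X) (φ fun i => t i x) +
    ∑ i, (t i - algebraMap ℝ (SmoothFun X) (t i x)) * P i
  have hk : g.1 =ᶠ[𝓝 x] k.1 := by
    filter_upwards [hg] with y hy
    rw [hy, h]
    simp [k, P]
  rw [derivation_local Z hk]
  simp [k, P, hψc]

namespace DiffSpace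

/-- The subset `S ⊆ X` with the induced structure: a function on `S` is smooth if it is locally the
restriction of a smooth function on `X`. -/
def sub (X : DiffSpace.{u}) (S : Set X) : DiffSpace.{u} :=
  generate S {g | ∃ f : SmoothFun X, g = fun x => f x.1}

/-- The product `X × Y`. -/
def prod (X : DiffSpace.{u}) (Y : DiffSpace.{v}) : DiffSpace.{max u v} :=
  generate (X × Y) ({g | ∃ f : SmoothFun X, g = fun p => f p.1} ∪ {g | ∃ f : SmoothFun Y, g = fun p => f p.2})

/-- The space `ℝ^ι`, `ι` finite or infinite; smooth functions depend, locally, on finitely many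
coordinates, and smoothly on these. The topology is the product topology. -/
def coordSpace (ι : Type) : DiffSpace.{0} := generate (ι → ℝ) {g | ∃ i, g = fun v => v i}

end DiffSpace

/-- The inclusion `S ↪ X`. -/
def inclusion (X : DiffSpace.{u}) (S : Set X) : SMap (X.sub S) X where
  toFun := Subtype.val
  smooth' g hg := subset_genSet _ ⟨⟨g, hg⟩, rfl⟩

theorem nhds_sub {X : DiffSpace.{u}} {S : Set X} (x : X.sub S) :
    𝓝 x = comap (Subtype.val : S → X) (𝓝 x.1) := by
  have h : (inferInstance : TopologicalSpace (X.sub S)) =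
      TopologicalSpace.induced (Subtype.val : S → X) inferInstance := by
    apply le_antisymm
    · exact continuous_iff_le_induced.1 (inclusion X S).continuous
    · change _ ≤ initialTop (genSet _)
      rw [initialTop_genSet, ← continuous_id_iff_le]
      let _ : TopologicalSpace S := TopologicalSpace.induced (Subtype.val : S → X) inferInstance
      refine continuous_initialTop ?_
      rintro f ⟨g, rfl⟩
      exact (smoothFun_continuous g).comp continuous_induced_dom
  exact (congrArg (fun T => @nhds _ T x) h).trans (nhds_induced _ _)

theorem exists_extension {X : DiffSpace.{u}} {S : Set X} (g : SmoothFun (X.sub S)) (x : X.sub S) :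
    ∃ f : SmoothFun X, g.1 =ᶠ[𝓝 x] ((inclusion X S).pull f).1 := by
  obtain ⟨κ, _, φ, t, hφ, ht, h⟩ := g.2 x
  choose f hf using ht
  refine ⟨⟨_, X.comp_mem φ hφ (fun i => (f i).1) fun i => (f i).2⟩, ?_⟩
  let S₀ : Set (S → ℝ) := {g | ∃ f : SmoothFun X, g = fun x => f x.1}
  have h' : g.1 =ᶠ[@nhds S (initialTop (genSet S₀)) x] fun y => φ fun i => t i y := by
    rw [initialTop_genSet]; exact h
  refine EventuallyEq.trans h' (Eventually.of_forall fun y => ?_)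
  simp only [hf]
  rfl

/-- Diffeomorphisms. -/
structure Diffeo (X : DiffSpace.{u}) (Y : DiffSpace.{v}) where
  toSMap : SMap X Y
  invSMap : SMap Y X
  left_inv : ∀ x, invSMap (toSMap x) = x
  right_inv : ∀ y, toSMap (invSMap y) = y

/-- `X` is, near `x`, diffeomorphic to an open subset of `ℝ^ι`. -/
def HasChartAt (ι : Type) (X : DiffSpace.{u}) (x : X) : Prop :=
  ∃ U : Set X, IsOpen U ∧ x ∈ U ∧ ∃ V : Set (coordSpace ι), IsOpen V ∧
    Nonempty (Diffeo (X.sub U) ((coordSpace ι).sub V))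

/-- Smooth manifolds of dimension `0, 1, 2, …, ∞`: Hausdorff, second countable, and locally
diffeomorphic to open subsets of `ℝ^ι` for a fixed countable `ι`. -/
structure IsSmoothManifold (X : DiffSpace.{u}) : Prop where
  hausdorff : T2Space X
  secondCountable : SecondCountableTopology X
  charts : ∃ ι : Type, Countable ι ∧ ∀ x : X, HasChartAt ι X x

/-- `S` is an embedded finite-dimensional smooth submanifold: with the structure induced from `X`
it is locally diffeomorphic to open subsets of `ℝ^d`. -/
def IsSubmanifold (X : DiffSpace.{u}) (S : Set X) : Prop :=
  ∀ x : X.sub S, ∃ d : ℕ, HasChartAt (Fin d) (X.sub S) x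

/-- `τ : W → X` is a smooth (locally trivial) fibre bundle; the typical fibre is a manifold of finite
or infinite dimension. -/
structure IsFibreBundle {W : DiffSpace.{w}} {X : DiffSpace.{u}} (τ : SMap W X) : Prop where
  surjective : Function.Surjective τ
  locallyTrivial : ∃ F : DiffSpace.{w}, IsSmoothManifold F ∧ ∀ x : X, ∃ U : Set X,
    IsOpen U ∧ x ∈ U ∧ ∃ e : Diffeo (W.sub (τ ⁻¹' U)) ((X.sub U).prod F),
      ∀ y, (e.toSMap y).1.1 = τ y.1

/-! ### Jets -/

/-- Smooth sections of `p : B → M`. -/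
def SmoothSection {B : DiffSpace.{v}} {M : DiffSpace.{u}} (p : SMap B M) :=
  {f : SMap M B // ∀ x, p (f x) = x}

/-- The function `X₁ (X₂ (⋯ X_r (h ∘ f)))` on `M`, for vector fields `X₁, …, X_r` on `M`, a smooth
function `h` on `B` and a section `f`. -/
def diffOp {B : DiffSpace.{v}} {M : DiffSpace.{u}} {p : SMap B M} (h : SmoothFun B) (L : List (VectorField M))
    (f : SmoothSection p) : SmoothFun M :=
  L.foldr (fun X g => X g) (f.1.pull h)

/-- `(x, f)` and `(x', f')` have the same jet of order `k` if `x = x'` and the graphs of `f` and `f'`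
are tangent at `x` with order `k`, that is, all derivatives of order at most `k` of `h ∘ f` and
`h ∘ f'` agree at `x`, for all smooth `h` on `B`. In a vector bundle over a manifold every germ of a
section is the germ of a global section, so that global sections give all jets. -/
def jetSetoid {B : DiffSpace.{v}} {M : DiffSpace.{u}} (p : SMap B M) (k : ℕ∞) :
    Setoid (M × SmoothSection p) where
  r a b := a.1 = b.1 ∧ ∀ (h : SmoothFun B) (L : List (VectorField M)), (L.length : ℕ∞) ≤ k →
    diffOp h L a.2 a.1 = diffOp h L b.2 b.1
  iseqv := ⟨fun _ => ⟨rfl, fun _ _ _ => rfl⟩, fun h => ⟨h.1.symm, fun a b c => (h.2 a b c).symm⟩,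
    fun h h' => ⟨h.1.trans h'.1, fun a b c => (h.2 a b c).trans (h'.2 a b c)⟩⟩

/-- The set of `k`-jets, `k = 0, 1, …, ∞`. -/
def JetSet {B : DiffSpace.{v}} {M : DiffSpace.{u}} (p : SMap B M) (k : ℕ∞) :=
  Quotient (jetSetoid p k)

/-- The functions `[f]_x^k ↦ X₁ ⋯ X_r (h ∘ f) (x)` with `r ≤ k`; they contain the usual jet
coordinates. -/
def jetGenerators {B : DiffSpace.{v}} {M : DiffSpace.{u}} (p : SMap B M) (k : ℕ∞) :
    Set (JetSet p k → ℝ) :=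
  {g | ∃ (h : SmoothFun B) (L : List (VectorField M)), (L.length : ℕ∞) ≤ k ∧ ∀ f x, g (Quotient.mk (jetSetoid p k) (x, f)) = diffOp h L f x}

/-- The jet space `J^k(p)`, `k = 0, 1, …, ∞`. -/
def JetSpace {B : DiffSpace.{v}} {M : DiffSpace.{u}} (p : SMap B M) (k : ℕ∞) : DiffSpace.{max u v} :=
  generate (JetSet p k) (jetGenerators p k)

/-- The jet `[f]_x^k`. -/
def jet {B : DiffSpace.{v}} {M : DiffSpace.{u}} {p : SMap B M} (k : ℕ∞) (f : SmoothSection p) (x : M) :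
    JetSpace p k :=
  Quotient.mk (jetSetoid p k) (x, f)

section Jets

variable {B : DiffSpace.{v}} {M : DiffSpace.{u}} {p : SMap B M}

theorem jet_surjective {k : ℕ∞} (θ : JetSpace p k) : ∃ (f : SmoothSection p) (x : M), θ = jet k f x :=
  Quotient.inductionOn θ fun a => ⟨a.2, a.1, rfl⟩

/-- The section `x ↦ [f]_x^k` of the jet bundle. -/
def jetProl (k : ℕ∞) (f : SmoothSection p) : SMap M (JetSpace p k) :=
  SMap.intoGenerate (fun x => (jet k f x : JetSpace p k)) (by
    rintro g ⟨h, L, -, hg⟩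
    rw [show g ∘ (fun x => (jet k f x : JetSpace p k)) = (diffOp h L f).1 from funext fun x => hg f x]
    exact (diffOp h L f).2)

/-- The function `[f]_x^k ↦ X₁ ⋯ X_r (h ∘ f) (x)`. -/
def jetFun (k : ℕ∞) (h : SmoothFun B) (L : List (VectorField M)) (hL : (L.length : ℕ∞) ≤ k) : SmoothFun (JetSpace p k) :=
  ⟨fun θ => Quotient.lift (fun a : M × SmoothSection p => diffOp h L a.2 a.1) (fun a b e => (id e : a.1 = b.1 ∧ ∀ (h : SmoothFun B) (L : List (VectorField M)), (L.length : ℕ∞) ≤ k →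
      diffOp h L a.2 a.1 = diffOp h L b.2 b.1).2 h L hL) θ,
    subset_genSet _ ⟨h, L, hL, fun _ _ => rfl⟩⟩

/-- The projection `J^k(p) → J^l(p)`, `l ≤ k`. -/
def jetRes {k l : ℕ∞} (hkl : l ≤ k) : SMap (JetSpace p k) (JetSpace p l) :=
  SMap.intoGenerate (fun θ => Quotient.map' (s₁ := jetSetoid p k) (s₂ := jetSetoid p l) id
      (fun _ _ e => ⟨e.1, fun h L hL => e.2 h L (hL.trans hkl)⟩) θ) (by
    rintro g ⟨h, L, hL, hg⟩
    refine subset_genSet _ ⟨h, L, hL.trans hkl, fun f x => hg f x⟩)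

/-- The projection `J^k(p) → M`. -/
def jetBase (p : SMap B M) (k : ℕ∞) : SMap (JetSpace p k) M where
  toFun θ := Quotient.lift (fun a : M × SmoothSection p => a.1) (fun _ _ e => And.left e) θ
  smooth' g hg := subset_genSet _ ⟨p.pull ⟨g, hg⟩, [], by simp, fun f x => by
    simp only [diffOp, List.foldr]
    change g x = g (p (f.1 x))
    rw [f.2]⟩

theorem jet_local {k : ℕ∞} (G : SmoothFun (JetSpace p k)) (θ : JetSpace p k) : ∃ (κ : Type) (_ : Fintype κ)
    (φ : (κ → ℝ) → ℝ) (h : κ → SmoothFun B) (L : κ → List (VectorField M)) (hL : ∀ i, ((L i).length : ℕ∞) ≤ k),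
    ContDiff ℝ ∞ φ ∧ G.1 =ᶠ[𝓝 θ] fun η => φ fun i => jetFun k (h i) (L i) (hL i) η := by
  obtain ⟨κ, i, φ, t, hφ, ht, e⟩ := G.2 θ
  choose h L hL hg using ht
  have h' : G.1 =ᶠ[@nhds _ (initialTop (genSet (jetGenerators p k))) θ]
      fun y => φ fun i => t i y := by
    rw [initialTop_genSet]; exact e
  refine ⟨κ, i, φ, h, L, hL, hφ, EventuallyEq.trans h' (Eventually.of_forall fun η => ?_)⟩
  obtain ⟨f, x, rfl⟩ := jet_surjective η
  exact congrArg φ (funext fun i => hg i f x)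

theorem deriv_jet (X : VectorField M) {k : ℕ∞} (G : SmoothFun (JetSpace p k)) {κ : Type} [Fintype κ] [DecidableEq κ]
    {φ : (κ → ℝ) → ℝ} {h : κ → SmoothFun B} {L : κ → List (VectorField M)} {hL : ∀ i, ((L i).length : ℕ∞) ≤ k}
    (hφ : ContDiff ℝ ∞ φ) (f : SmoothSection p) (x : M)
    (e : G.1 =ᶠ[𝓝 (jet k f x : JetSpace p k)] fun η => φ fun i => jetFun k (h i) (L i) (hL i) η) :
    X ((jetProl k f).pull G) x = ∑ i, fderiv ℝ φ (fun i => diffOp (h i) (L i) f x) (Pi.single i 1) *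
      diffOp (h i) (X :: L i) f x := by
  have := derivation_chain X φ hφ (fun i => diffOp (h i) (L i) f) ((jetProl k f).pull G) x
    ((jetProl k f).continuous.continuousAt.eventually e)
  exact this

theorem deriv_jet_congr (X : VectorField M) {k : ℕ∞} (G : SmoothFun (JetSpace p k)) {f f' : SmoothSection p} {x x' : M}
    (e : jet (k + 1) f x = jet (k + 1) f' x') :
    X ((jetProl k f).pull G) x = X ((jetProl k f').pull G) x' := by
  classical
  have e1 := Quotient.exact e
  have e2 : (jet k f x : JetSpace p k) = jet k f' x' :=
    Quotient.sound ⟨e1.1, fun h L hL => e1.2 h L (hL.trans le_self_add)⟩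
  obtain ⟨κ, i, φ, h, L, hL, hφ, e3⟩ := jet_local G (jet k f x)
  rw [deriv_jet X G hφ f x e3, deriv_jet X G hφ f' x' (by rw [← e2]; exact e3)]
  refine Finset.sum_congr rfl fun i _ => ?_
  congr 1
  · congr 2
    exact funext fun j => e1.2 _ _ ((hL j).trans le_self_add)
  · exact e1.2 _ _ (by simpa using hL i)

/-- The total derivative of `G` along `X`: at `[f]_x^∞` it is the derivative along `X_x` of the
restriction of `G` to the graph of the infinite jet of `f`. -/
def totalDeriv (X : VectorField M) (G : SmoothFun (JetSpace p ⊤)) : JetSpace p ⊤ → ℝ := fun θ =>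
  Quotient.lift (fun a : M × SmoothSection p => X ((jetProl ⊤ a.2).pull G) a.1)
    (fun _ _ e => deriv_jet_congr X G (Quotient.sound e)) θ

theorem totalDeriv_jet (X : VectorField M) (G : SmoothFun (JetSpace p ⊤)) (f : SmoothSection p) (x : M) :
    totalDeriv X G (jet ⊤ f x) = X ((jetProl ⊤ f).pull G) x := rfl

theorem totalDeriv_smooth (X : VectorField M) (G : SmoothFun (JetSpace p ⊤)) : totalDeriv X G ∈ (JetSpace p ⊤).smooth := by
  classical
  apply (JetSpace p ⊤).local_mem
  intro θ
  obtain ⟨κ, i, φ, h, L, hL, hφ, e⟩ := jet_local G θ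
  let K : SmoothFun (JetSpace p ⊤) := ∑ i, ⟨fun η => fderiv ℝ φ (fun j => jetFun ⊤ (h j) (L j) (hL j) η)
      (Pi.single i 1), (JetSpace p ⊤).comp_mem (fun v => fderiv ℝ φ v (Pi.single i 1))
        ((hφ.fderiv_right (m := ∞) (by simp)).clm_apply contDiff_const)
        (fun j => (jetFun ⊤ (h j) (L j) (hL j)).1) fun j => (jetFun ⊤ (h j) (L j) (hL j)).2⟩ *
      jetFun ⊤ (h i) (X :: L i) le_top
  have hK : ∀ η, K η = ∑ i, fderiv ℝ φ (fun j => jetFun ⊤ (h j) (L j) (hL j) η) (Pi.single i 1) *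
      jetFun ⊤ (h i) (X :: L i) le_top η := fun η => by simp [K, Finset.sum_apply]
  refine ⟨K.1, K.2, ?_⟩
  filter_upwards [eventually_eventually_nhds.2 e] with η hη
  obtain ⟨f, x, rfl⟩ := jet_surjective η
  rw [totalDeriv_jet, deriv_jet X G hφ f x hη, hK]
  rfl

end Jets

section Jets

variable {B : DiffSpace.{v}} {M : DiffSpace.{u}} {p : SMap B M}

theorem jetGen_lift {κ : Type} [Fintype κ] (h : κ → SmoothFun B) (L : κ → List (VectorField M)) (N : ℕ)
    (hN : ∀ i, (L i).length ≤ N) {φ : (κ → ℝ) → ℝ} (hφ : ContDiff ℝ ∞ φ) :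
    ∃ H : SmoothFun (JetSpace p N), ∀ (f : SmoothSection p) (x : M),
      H (jet N f x) = φ fun i => diffOp (h i) (L i) f x :=
  ⟨⟨_, (JetSpace p N).comp_mem φ hφ (fun i => (jetFun N (h i) (L i) (by exact_mod_cast hN i)).1)
    fun i => (jetFun N (h i) (L i) (by exact_mod_cast hN i)).2⟩, fun _ _ => rfl⟩

/-! ### Differential equations and their prolongations -/

/-- The first prolongation of an equation `E ⊆ J^k`: the set of all `[f]_x^{k+1}` such that
`[f]_x^k ∈ E` and the graph of the `k`-jet of `f` is tangent to `E` at `[f]_x^k`, that is, smooth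
functions vanishing on `E` have zero derivatives along the graph at this point. -/
def prolong {k : ℕ} (E : Set (JetSpace p k)) : Set (JetSpace p ((k + 1 : ℕ) : ℕ∞)) :=
  {θ | ∀ (f : SmoothSection p) (x : M), θ = jet _ f x → (jet k f x : JetSpace p k) ∈ E ∧
    ∀ G : SmoothFun (JetSpace p k), (∀ η ∈ E, G η = 0) → ∀ X : VectorField M, X ((jetProl k f).pull G) x = 0}

/-- The prolongations `E^s ⊆ J^{k+s}`. -/
def prolongation {k : ℕ} (E : Set (JetSpace p k)) : (s : ℕ) → Set (JetSpace p ((k + s : ℕ) : ℕ∞))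
  | 0 => E
  | s + 1 => prolong (prolongation E s)

/-- The infinite prolongation as a subset of `J^∞`. -/
def infProlongation {k : ℕ} (E : Set (JetSpace p k)) : Set (JetSpace p ⊤) :=
  {θ | ∀ s, jetRes (le_top : ((k + s : ℕ) : ℕ∞) ≤ ⊤) θ ∈ prolongation E s}

/-- The infinite prolongation `E^∞`. -/
def EInf {k : ℕ} (E : Set (JetSpace p k)) : DiffSpace.{max u v} := (JetSpace p ⊤).sub (infProlongation E)

/-- The projection `π_E : E^∞ → M`. -/
def projE {k : ℕ} (E : Set (JetSpace p k)) : SMap (EInf E) M := (jetBase p ⊤).comp (inclusion _ _)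

/-- Formally integrable equations: all prolongations are smooth manifolds, `E^∞ → M` is a smooth
bundle, and `E^∞` projects onto every `E^s`. -/
structure FormallyIntegrable {k : ℕ} (E : Set (JetSpace p k)) : Prop where
  submanifold : ∀ s, IsSubmanifold (JetSpace p ((k + s : ℕ) : ℕ∞)) (prolongation E s)
  bundle : IsFibreBundle (projE E)
  onto : ∀ s, ∀ η ∈ prolongation E s, ∃ θ ∈ infProlongation E,
    jetRes (le_top : ((k + s : ℕ) : ℕ∞) ≤ ⊤) θ = η

/-- The total derivatives are tangent to `E^∞`. -/
theorem totalDeriv_tangent {k : ℕ} {E : Set (JetSpace p k)} (hE : FormallyIntegrable E) (X : VectorField M)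
    (G : SmoothFun (JetSpace p ⊤)) (θ : EInf E) (h : ∀ᶠ η in 𝓝 θ, G η.1 = 0) : totalDeriv X G θ.1 = 0 := by
  classical
  obtain ⟨κ, _, φ, a, L, hL, hφ, e⟩ := jet_local G θ.1
  have h' : ∀ᶠ η : infProlongation E in comap Subtype.val (𝓝 θ.1), G η.1 = 0 :=
    (nhds_sub (X := JetSpace p ⊤) (S := infProlongation E) θ).symm.le h
  rw [eventually_comap] at h'
  have hU := e.and h'
  have hU' : {η : JetSpace p ⊤ | (G η = φ fun i => jetFun ⊤ (a i) (L i) (hL i) η) ∧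
      ∀ b : (infProlongation E), b.1 = η → G b.1 = 0} ∈ @nhds _ (initialTop (jetGenerators p ⊤)) θ.1 := by
    rw [← initialTop_genSet]
    exact hU
  obtain ⟨ι, _, ψ, t, hψ, ht, h1, h0⟩ := exists_bump hU'
  choose a' L' hL' ht' using ht
  obtain ⟨f, x, hθ⟩ := jet_surjective θ.1
  let N : ℕ := ∑ i, (L i).length + ∑ i, (L' i).length
  have hN : ∀ i, (L i).length ≤ k + N := fun i =>
    (Finset.single_le_sum (f := fun i => (L i).length) (fun _ _ => Nat.zero_le _)
      (Finset.mem_univ i)).trans (by omega)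
  have hN' : ∀ i, (L' i).length ≤ k + N := fun i =>
    (Finset.single_le_sum (f := fun i => (L' i).length) (fun _ _ => Nat.zero_le _)
      (Finset.mem_univ i)).trans (by omega)
  obtain ⟨H, hH⟩ := jetGen_lift (p := p) a L (k + N) hN hφ
  obtain ⟨K, hK⟩ := jetGen_lift (p := p) a' L' (k + N) hN' hψ
  have hv : ∀ η ∈ prolongation E N, (K * H) η = 0 := by
    intro η hη
    obtain ⟨ζ, hζ, rfl⟩ := hE.onto N η hη
    obtain ⟨g, y, rfl⟩ := jet_surjective ζ
    have e1 : H (jet _ g y) = φ fun i => diffOp (a i) (L i) g y := hH g y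
    have e2 : K (jet _ g y) = ψ fun i => t i (jet ⊤ g y) := by
      rw [hK g y]; exact congrArg ψ (funext fun i => (ht' i g y).symm)
    change K (jet _ g y) * H (jet _ g y) = 0
    by_cases hm : (jet ⊤ g y : JetSpace p ⊤) ∈ {η : JetSpace p ⊤ | (G η = φ fun i => jetFun ⊤ (a i) (L i) (hL i) η) ∧
      ∀ b : (infProlongation E), b.1 = η → G b.1 = 0}
    · have : H (jet _ g y) = 0 := by
        rw [e1]
        exact hm.1.symm.trans (hm.2 ⟨_, hζ⟩ rfl)
      rw [this, mul_zero]
    · rw [e2, h0 _ hm, zero_mul]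
  have hz := ((θ.2 (N + 1)) f x (by rw [hθ]; rfl)).2 (K * H) hv X
  rw [map_mul, Derivation.leibniz] at hz
  have k1 : K (jet _ f x) = 1 := by
    rw [hK f x, ← h1, hθ]; exact congrArg ψ (funext fun i => (ht' i f x).symm)
  have hG : (G.1 θ.1 = φ fun i => jetFun ⊤ (a i) (L i) (hL i) θ.1) := hU.self_of_nhds.1
  have hG0 : G θ.1 = 0 := hU.self_of_nhds.2 θ rfl
  have k2 : H (jet _ f x) = 0 := by
    rw [hH f x, ← hG0, hG, hθ]; rfl
  have hz2 : K (jet _ f x) * X ((jetProl _ f).pull H) x + H (jet _ f x) * X ((jetProl _ f).pull K) x = 0 := hz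
  rw [k1, k2, one_mul, zero_mul, add_zero] at hz2
  rw [hθ, totalDeriv_jet, ← hz2]
  apply Eq.trans (deriv_jet X G hφ f x (by rw [← hθ]; exact e))
  symm
  exact derivation_chain X φ hφ (fun i => diffOp (a i) (L i) f) ((jetProl _ f).pull H) x
    (Eventually.of_forall fun y => hH f y)

end Jets

/-- A flat connection in `π : X → M`: a `C^∞(M)`-linear map `D(M) → D(X)` which lifts vector fields
and preserves commutators. Its distribution is spanned by the lifted fields. -/
structure FlatConnection {X : DiffSpace.{v}} {M : DiffSpace.{u}} (π : SMap X M) where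
  lift : VectorField M → VectorField X
  lift_add : ∀ Y Z, lift (Y + Z) = lift Y + lift Z
  lift_smul : ∀ (g : SmoothFun M) Y, lift (g • Y) = π.pull g • lift Y
  lift_pull : ∀ Y (g : SmoothFun M), lift Y (π.pull g) = π.pull (Y g)
  flat : ∀ Y Z, lift ⁅Y, Z⁆ = ⁅lift Y, lift Z⁆

section Jets

variable {B : DiffSpace.{v}} {M : DiffSpace.{u}} {p : SMap B M}

/-- The restriction of a function on `J^∞` to `E^∞`. -/
def restrict {k : ℕ} (E : Set (JetSpace p k)) (G : SmoothFun (JetSpace p ⊤)) : SmoothFun (EInf E) := (inclusion _ _).pull G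

theorem exists_restrict {k : ℕ} (E : Set (JetSpace p k)) (g : SmoothFun (EInf E)) (θ : EInf E) :
    ∃ G : SmoothFun (JetSpace p ⊤), g.1 =ᶠ[𝓝 θ] (restrict E G).1 := exists_extension g θ

/-- The total derivative as a smooth function. -/
def totalDerivC (X : VectorField M) (G : SmoothFun (JetSpace p ⊤)) : SmoothFun (JetSpace p ⊤) := ⟨totalDeriv X G, totalDeriv_smooth X G⟩

theorem pull_totalDerivC (X : VectorField M) (G : SmoothFun (JetSpace p ⊤)) (f : SmoothSection p) :
    (jetProl ⊤ f).pull (totalDerivC X G) = X ((jetProl ⊤ f).pull G) := rfl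

theorem totalDerivC_lie (Y Z : VectorField M) (G : SmoothFun (JetSpace p ⊤)) : totalDerivC ⁅Y, Z⁆ G =
    totalDerivC Y (totalDerivC Z G) - totalDerivC Z (totalDerivC Y G) := by
  ext θ
  obtain ⟨f, x, rfl⟩ := jet_surjective θ
  have h1 : totalDerivC ⁅Y, Z⁆ G (jet ⊤ f x) = ⁅Y, Z⁆ ((jetProl ⊤ f).pull G) x := rfl
  have h2 : ∀ Y Z : VectorField M, totalDerivC Y (totalDerivC Z G) (jet ⊤ f x) =
      Y ((jetProl ⊤ f).pull (totalDerivC Z G)) x := fun _ _ => rfl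
  refine h1.trans (Eq.trans ?_ (congrArg₂ (· - ·) (h2 Y Z) (h2 Z Y)).symm)
  rw [pull_totalDerivC, pull_totalDerivC, Derivation.commutator_apply]
  rfl

theorem totalDerivC_add (X : VectorField M) (G H : SmoothFun (JetSpace p ⊤)) :
    totalDerivC X (G + H) = totalDerivC X G + totalDerivC X H := by
  ext θ
  obtain ⟨f, x, rfl⟩ := jet_surjective θ
  change X ((jetProl ⊤ f).pull (G + H)) x = X ((jetProl ⊤ f).pull G) x + X ((jetProl ⊤ f).pull H) x
  simp

/-- The Cartan connection on `J^∞`: its planes are the tangent planes to graphs of infinite jets. -/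
def cartanJet (p : SMap B M) : FlatConnection (jetBase p ⊤) where
  lift X := Derivation.mk'
    { toFun := totalDerivC X
      map_add' := totalDerivC_add X
      map_smul' := by
        intro r G
        ext θ
        obtain ⟨f, x, rfl⟩ := jet_surjective θ
        change X ((jetProl ⊤ f).pull (r • G)) x = r * X ((jetProl ⊤ f).pull G) x
        simp }
    (by
      intro G H
      ext θ
      obtain ⟨f, x, rfl⟩ := jet_surjective θ
      change X ((jetProl ⊤ f).pull (G * H)) x = (jetProl ⊤ f).pull G x * X ((jetProl ⊤ f).pull H) x
        + (jetProl ⊤ f).pull H x * X ((jetProl ⊤ f).pull G) x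
      simp)
  lift_add Y Z := by
    ext G θ
    obtain ⟨f, x, rfl⟩ := jet_surjective θ
    rfl
  lift_smul g Y := by
    ext G θ
    obtain ⟨f, x, rfl⟩ := jet_surjective θ
    rfl
  lift_pull Y g := by
    ext θ
    obtain ⟨f, x, rfl⟩ := jet_surjective θ
    rfl
  flat Y Z := by
    ext G : 1
    rw [Derivation.commutator_apply]
    exact totalDerivC_lie Y Z G

variable {k : ℕ} {E : Set (JetSpace p k)}

theorem cartan_congr (hE : FormallyIntegrable E) (X : VectorField M) {G H : SmoothFun (JetSpace p ⊤)} {θ : EInf E}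
    (h : (restrict E G).1 =ᶠ[𝓝 θ] (restrict E H).1) :
    (cartanJet p).lift X G θ.1 = (cartanJet p).lift X H θ.1 := by
  have h1 := totalDeriv_tangent hE X (G - H) θ (by
    filter_upwards [h] with η hη
    change G η.1 - H η.1 = 0
    exact sub_eq_zero.2 hη)
  have h2 : (cartanJet p).lift X (G - H) θ.1 = 0 := h1
  rw [map_sub] at h2
  exact sub_eq_zero.1 h2

/-- The total derivative at `θ ∈ E^∞` of a function on `E^∞`, computed through any local extension
to `J^∞`. -/
def cartanFun (X : VectorField M) (g : SmoothFun (EInf E)) (θ : EInf E) : ℝ :=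
  (cartanJet p).lift X (exists_restrict E g θ).choose θ.1

theorem cartanFun_eq (hE : FormallyIntegrable E) (X : VectorField M) {g : SmoothFun (EInf E)} {θ : EInf E}
    {G : SmoothFun (JetSpace p ⊤)} (h : g.1 =ᶠ[𝓝 θ] (restrict E G).1) :
    cartanFun X g θ = (cartanJet p).lift X G θ.1 :=
  cartan_congr hE X ((exists_restrict E g θ).choose_spec.symm.trans h)

theorem cartanFun_eventuallyEq (hE : FormallyIntegrable E) (X : VectorField M) {g : SmoothFun (EInf E)} {θ : EInf E}
    {G : SmoothFun (JetSpace p ⊤)} (h : g.1 =ᶠ[𝓝 θ] (restrict E G).1) :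
    cartanFun X g =ᶠ[𝓝 θ] (restrict E ((cartanJet p).lift X G)).1 := by
  filter_upwards [eventually_eventually_nhds.2 h] with η hη
  exact cartanFun_eq hE X hη

/-- The total derivative of a function on `E^∞`, as a function on `E^∞`. -/
def cartanC (hE : FormallyIntegrable E) (X : VectorField M) (g : SmoothFun (EInf E)) : SmoothFun (EInf E) :=
  ⟨cartanFun X g, (EInf E).local_mem _ fun θ =>
    ⟨_, (restrict E _).2, cartanFun_eventuallyEq hE X (exists_restrict E g θ).choose_spec⟩⟩

theorem cartanC_lie (hE : FormallyIntegrable E) (Y Z : VectorField M) (g : SmoothFun (EInf E)) :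
    cartanC hE ⁅Y, Z⁆ g = cartanC hE Y (cartanC hE Z g) - cartanC hE Z (cartanC hE Y g) := by
  ext θ
  obtain ⟨G, hG⟩ := exists_restrict E g θ
  have h1 : cartanC hE ⁅Y, Z⁆ g θ = totalDerivC ⁅Y, Z⁆ G θ.1 := cartanFun_eq hE _ hG
  have h2 : ∀ Y Z : VectorField M, cartanC hE Y (cartanC hE Z g) θ =
      totalDerivC Y (totalDerivC Z G) θ.1 :=
    fun Y Z => cartanFun_eq hE Y (cartanFun_eventuallyEq hE Z hG)
  refine h1.trans (Eq.trans ?_ (congrArg₂ (· - ·) (h2 Y Z) (h2 Z Y)).symm)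
  rw [totalDerivC_lie]
  rfl

theorem cartanC_pull (hE : FormallyIntegrable E) (Y : VectorField M) (a : SmoothFun M) :
    cartanC hE Y ((projE E).pull a) = (projE E).pull (Y a) := by
  apply Subtype.ext
  funext θ
  have h : ((projE E).pull a).1 =ᶠ[𝓝 θ] (restrict E ((jetBase p ⊤).pull a)).1 := EventuallyEq.rfl
  have h1 : cartanC hE Y ((projE E).pull a) θ = totalDerivC Y ((jetBase p ⊤).pull a) θ.1 :=
    cartanFun_eq hE Y h
  have h2 : totalDerivC Y ((jetBase p ⊤).pull a) = (jetBase p ⊤).pull (Y a) :=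
    (cartanJet p).lift_pull Y a
  rw [h1, h2]
  rfl

/-- The lift of a vector field on `M` by the Cartan connection of `E^∞`. -/
def cartanLift (hE : FormallyIntegrable E) (X : VectorField M) : VectorField (EInf E) :=
  Derivation.mk'
    { toFun := cartanC hE X
      map_add' := by
        intro g h
        ext θ
        obtain ⟨G, hG⟩ := exists_restrict E g θ
        obtain ⟨H, hH⟩ := exists_restrict E h θ
        change cartanFun X (g + h) θ = cartanFun X g θ + cartanFun X h θ
        rw [cartanFun_eq hE X hG, cartanFun_eq hE X hH, cartanFun_eq hE X (G := G + H) (hG.add hH)]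
        simp
      map_smul' := by
        intro r g
        ext θ
        obtain ⟨G, hG⟩ := exists_restrict E g θ
        change cartanFun X (r • g) θ = r * cartanFun X g θ
        rw [cartanFun_eq hE X hG, cartanFun_eq hE X (G := r • G) (hG.const_smul r)]
        simp }
    (by
      intro g h
      ext θ
      obtain ⟨G, hG⟩ := exists_restrict E g θ
      obtain ⟨H, hH⟩ := exists_restrict E h θ
      change cartanFun X (g * h) θ = g θ * cartanFun X h θ + h θ * cartanFun X g θ
      rw [cartanFun_eq hE X hG, cartanFun_eq hE X hH, cartanFun_eq hE X (G := G * H) (hG.mul hH),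
        show g θ = G θ.1 from hG.self_of_nhds, show h θ = H θ.1 from hH.self_of_nhds]
      simp)

/-- The Cartan connection of `E^∞`: the restriction of the Cartan connection of `J^∞`. -/
def cartan (hE : FormallyIntegrable E) : FlatConnection (projE E) where
  lift := cartanLift hE
  lift_add Y Z := by
    ext g θ
    obtain ⟨G, hG⟩ := exists_restrict E g θ
    change cartanFun (Y + Z) g θ = cartanFun Y g θ + cartanFun Z g θ
    simp only [cartanFun_eq hE _ hG, (cartanJet p).lift_add]
    rfl
  lift_smul a Y := by
    ext g θ
    obtain ⟨G, hG⟩ := exists_restrict E g θ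
    change cartanFun (a • Y) g θ = (projE E).pull a θ * cartanFun Y g θ
    simp only [cartanFun_eq hE _ hG, (cartanJet p).lift_smul]
    rfl
  lift_pull Y a := cartanC_pull hE Y a
  flat Y Z := by
    refine Derivation.ext fun g => ?_
    have h : ⁅cartanLift hE Y, cartanLift hE Z⁆ g =
        cartanLift hE Y (cartanLift hE Z g) - cartanLift hE Z (cartanLift hE Y g) :=
      Derivation.commutator_apply _
    rw [h]
    exact cartanC_lie hE Y Z g

end Jets

/-! ### Smooth manifolds and bundles as differential spaces -/

/-- A smooth manifold, with its algebra of smooth functions. -/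
def ofManifold {E : Type*} [NormedAddCommGroup E] [NormedSpace ℝ E] {H : Type*}
    [TopologicalSpace H] (I : ModelWithCorners ℝ E H) (M : Type u) [TopologicalSpace M]
    [ChartedSpace H M] : DiffSpace.{u} where
  carrier := M
  smooth := {f | ContMDiff I 𝓘(ℝ) ∞ f}
  comp_mem := by
    intro κ _ φ hφ f hf
    exact hφ.contMDiff.comp (contMDiff_pi_space.2 hf)
  local_mem := by
    intro g hg x
    obtain ⟨f, hf, h⟩ := hg x
    refine (hf x).congr_of_eventuallyEq ?_
    have hc : @Continuous _ _ _ (initialTop {f : M → ℝ | ContMDiff I 𝓘(ℝ) ∞ f}) (id : M → M) :=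
      continuous_initialTop fun f hf => hf.continuous
    exact nhds_mono (continuous_id_iff_le.1 hc) h

/-- The projection `π : V → M` of a smooth vector bundle. -/
def bundleProjection {n : ℕ} {M : Type u} [TopologicalSpace M]
    [ChartedSpace (EuclideanSpace ℝ (Fin n)) M] (F : Type*) [NormedAddCommGroup F]
    [NormedSpace ℝ F] (V : M → Type v) [∀ x, AddCommGroup (V x)] [∀ x, Module ℝ (V x)]
    [TopologicalSpace (Bundle.TotalSpace F V)] [∀ x, TopologicalSpace (V x)] [FiberBundle F V]
    [VectorBundle ℝ F V] [ContMDiffVectorBundle ∞ F V (𝓡 n)] :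
    SMap (ofManifold ((𝓡 n).prod 𝓘(ℝ, F)) (Bundle.TotalSpace F V)) (ofManifold (𝓡 n) M) where
  toFun := Bundle.TotalSpace.proj
  smooth' g hg := by
    have h : ContMDiff (𝓡 n) 𝓘(ℝ) ∞ (show M → ℝ from g) := hg
    exact h.comp (Bundle.contMDiff_proj V)

/-! ### Coverings -/

/-- The bundle `τ : W → X`, with the flat connection `CW` in `W → M`, is a covering over `X` with its
flat connection `CX`: `τ_* ∘ CW = CX`. -/
structure IsCovering {M : DiffSpace.{u}} {X : DiffSpace.{v}} {W : DiffSpace.{w}} {π : SMap X M}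
    (CX : FlatConnection π) (τ : SMap W X) (CW : FlatConnection (π.comp τ)) : Prop where
  bundle : IsFibreBundle τ
  compatible : ∀ (Y : VectorField M) (f : SmoothFun X), CW.lift Y (τ.pull f) = τ.pull (CX.lift Y f)

/-! ### Tangent vectors -/

/-- Tangent vectors at `x`: derivations `C^∞(X) → ℝ` at `x`. -/
structure TangentVector (X : DiffSpace.{u}) (x : X) where
  toLinearMap : SmoothFun X →ₗ[ℝ] ℝ
  leibniz : ∀ f g : SmoothFun X, toLinearMap (f * g) = f x * toLinearMap g + g x * toLinearMap f

instance (X : DiffSpace.{u}) (x : X) : CoeFun (TangentVector X x) (fun _ => SmoothFun X → ℝ) :=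
  ⟨fun ξ => ξ.toLinearMap⟩

/-- The value `Z_x` of a vector field. -/
def valueAt {X : DiffSpace.{u}} (Z : VectorField X) (x : X) : TangentVector X x where
  toLinearMap :=
    { toFun := fun f => Z f x
      map_add' := fun f g => by simp
      map_smul' := fun r f => by simp }
  leibniz f g := by simp

/-- The differential `F_* : T_x X → T_{F(x)} Y`. -/
def pushforward {X : DiffSpace.{u}} {Y : DiffSpace.{v}} (F : SMap X Y) {x : X}
    (ξ : TangentVector X x) : TangentVector Y (F x) where
  toLinearMap := ξ.toLinearMap ∘ₗ F.pull.toLinearMap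
  leibniz f g := by
    have := ξ.leibniz (F.pull f) (F.pull g)
    rw [← map_mul] at this
    exact this

section Vertical

variable {M : DiffSpace.{u}} {X : DiffSpace.{v}} {W : DiffSpace.{w}}

/-- A `π`-vertical tangent vector of `X` at some point. -/
structure VerticalVector (π : SMap X M) where
  pt : X
  vec : TangentVector X pt
  vertical : ∀ g : SmoothFun M, vec (π.pull g) = 0

/-- The total space of the bundle `T^v π → X` of `π`-vertical tangent vectors; its smooth structure
is generated by the functions `f` and `df`, for `f` smooth on `X`. -/
def verticalTangent (π : SMap X M) : DiffSpace.{v} :=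
  generate (VerticalVector π)
    ({F | ∃ f : SmoothFun X, F = fun v => f v.pt} ∪ {F | ∃ f : SmoothFun X, F = fun v => v.vec f})

/-- The projection `π^v : T^v π → X`. -/
def verticalProj (π : SMap X M) : SMap (verticalTangent π) X where
  toFun v := VerticalVector.pt v
  smooth' g hg := subset_genSet _ (Or.inl ⟨⟨g, hg⟩, rfl⟩)

/-- The function `df : v ↦ v(f)` on `T^v π`. -/
def dFun (π : SMap X M) (f : SmoothFun X) : SmoothFun (verticalTangent π) :=
  ⟨fun v => VerticalVector.vec v f, subset_genSet _ (Or.inr ⟨f, rfl⟩)⟩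

/-- `τ_* : T^v(π ∘ τ) → T^v π`. -/
def verticalMap (π : SMap X M) (τ : SMap W X) :
    SMap (verticalTangent (π.comp τ)) (verticalTangent π) :=
  SMap.intoGenerate
    (fun v : VerticalVector (π.comp τ) => (⟨τ v.pt, pushforward τ v.vec, v.vertical⟩ :
      VerticalVector π)) (by
    rintro g (⟨f, rfl⟩ | ⟨f, rfl⟩)
    · exact subset_genSet _ (Or.inl ⟨τ.pull f, rfl⟩)
    · exact subset_genSet _ (Or.inr ⟨τ.pull f, rfl⟩))

/-- The Cartan distribution of the covering `π^v : T^v π → X`: the tangent vector `ξ` to `T^v π` at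
`v` is the value at `v` of the horizontal lift of the vector field `Y` on `M`. For a section `S` of
`T^v π`, i.e. a vertical field, the covariant derivative along `Y` is the commutator `[CX(Y), S]`
(which is vertical); hence the lift of `Y` is the vector field on `T^v π` that maps a function `f` on
`X` to `CX(Y)(f)` and maps `df` to `d(CX(Y)(f))`. Since the functions `f` and `df` generate the smooth
functions, this determines `ξ`. -/
structure IsVerticalLift {π : SMap X M} (CX : FlatConnection π) (Y : VectorField M)
    (v : verticalTangent π) (ξ : TangentVector (verticalTangent π) v) : Prop where
  on_base : ∀ f : SmoothFun X, ξ ((verticalProj π).pull f) = CX.lift Y f (verticalProj π v)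
  on_differentials : ∀ f : SmoothFun X, ξ (dFun π f) = dFun π (CX.lift Y f) v

/-- `s : W → T^v π` takes the Cartan distribution of `W` to that of `T^v π`. -/
def PreservesCartan {π : SMap X M} (CX : FlatConnection π) {ρ : SMap W M} (CW : FlatConnection ρ)
    (s : SMap W (verticalTangent π)) : Prop :=
  ∀ (Y : VectorField M) (w : W), IsVerticalLift CX Y (s w) (pushforward s (valueAt (CW.lift Y) w))

/-- `s : W → T^v π` is a `τ`-shadow: `π^v ∘ s = τ` and `s_*` preserves the Cartan distribution. -/
structure IsShadow {π : SMap X M} (CX : FlatConnection π) (τ : SMap W X)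
    (CW : FlatConnection (π.comp τ)) (s : SMap W (verticalTangent π)) : Prop where
  lies_over : (verticalProj π).comp s = τ
  preservesCartan : PreservesCartan CX CW s

/-- The module `CD(X)` of vector fields lying in the distribution of the flat connection. -/
def cartanModule {π : SMap X M} (CX : FlatConnection π) : Submodule (SmoothFun X) (VectorField X) :=
  Submodule.span (SmoothFun X) (Set.range CX.lift)

/-- `S` is a symmetry: a vertical vector field with `[S, CD(X)] ⊆ CD(X)`. When `X` is the total space
of a covering these are the nonlocal symmetries in this covering. -/
structure IsNonlocalSymmetry {π : SMap X M} (CX : FlatConnection π) (S : VectorField X) : Prop where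
  vertical : ∀ g : SmoothFun M, S (π.pull g) = 0
  normalizes : ∀ Z ∈ cartanModule CX, ⁅S, Z⁆ ∈ cartanModule CX

/-- The section `x ↦ S_x` of `T^v π → X` given by a vertical vector field `S`. -/
def toSection (π : SMap X M) (S : VectorField X) (hS : ∀ g : SmoothFun M, S (π.pull g) = 0) :
    SMap X (verticalTangent π) :=
  SMap.intoGenerate
    (fun x => (⟨x, valueAt S x, fun g => congrArg (fun f : SmoothFun X => f x) (hS g)⟩ :
      VerticalVector π)) (by
    rintro g (⟨f, rfl⟩ | ⟨f, rfl⟩)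
    · exact f.2
    · exact (S f).2)

end Vertical

end PDEGeom

end

open PDEGeom PDEGeom.DiffSpace

-- A shadow gives, at each point `w` of `W`, a velocity of the image `τ w` in `X = E^∞`, but no
-- motion of `w` itself. Let `W'` be the space of infinite jets of curves `γ` in `W` whose image in
-- `X` moves with the prescribed velocity: `d f(τ(γ(t)))/dt = s(γ(t))(f)` for all smooth `f` on `X`.
-- Algebraically such a jet is a homomorphism `C^∞(W) → ℝ⟦t⟧` whose constant term is evaluation at a
-- point, so no actual curves are needed. The Taylor coefficients `c_n(f)` generate the smooth
-- functions on `W'`, and `τ'` sends a jet to its point.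
--
-- Translation in `t` is a vector field `S` on `W'`, with `S(c_n(f)) = (n+1) c_{n+1}(f)`; at order
-- zero the defining relation says that `S` projects to `s`. The connection of `W` acts
-- coefficientwise, `c_n(f) ↦ c_n(CW(Y)f)`. This respects the relations because `s` is a shadow:
-- `CW(Y)(s^* df) = s^* d(CX(Y)f)`. Coefficientwise operations commute with `d/dt`, so `S` is a
-- symmetry. Since `s` has vertical values, functions from `M` are constant along the jets
-- (`hom_const`), which makes the lift `C^∞(M)`-linear and `S` vertical. The argument applies to any
-- `X` with a flat connection (`exists_reconstruction`).
--
-- It remains to see that `W'` is a bundle and that these vector fields exist. In a trivialization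
-- `U × F` the relation is an ordinary differential equation for the `U`-component, driven by an
-- arbitrary curve in `F`. A formal solution exists and is unique for each initial point, so that
-- locally `W'` is `U × (jets of curves in F)` (`exists_diffeo_prod`); over a chart of `F` the
-- Taylor coefficients of the coordinates are free coordinates (`exists_diffeo_jetSet`). Uniqueness
-- is proved one coefficient at a time (`IsTwisted.eq_zero`), existence by the formal exponential of
-- a vector field (`flow`). The linearized argument shows that every derivation over a jet which is
-- compatible with the relations is a tangent vector (`HasTangents`); this is what produces vector
-- fields on `W'` (`exists_field`).

universe u'

noncomputable section

namespace PDEGeom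

/-! ### Local generators -/

section Basic

variable {X : DiffSpace.{u}} {Y : DiffSpace.{v}} {Z : DiffSpace.{w}}

/-- `f` is, near `x`, a smooth function of finitely many members of `G`. -/
def IsLocFun (G : Set (SmoothFun X)) (x : X) (f : SmoothFun X) : Prop :=
  ∃ (κ : Type) (_ : Fintype κ) (φ : (κ → ℝ) → ℝ) (t : κ → SmoothFun X),
    ContDiff ℝ ∞ φ ∧ (∀ i, t i ∈ G) ∧ f.1 =ᶠ[𝓝 x] fun y => φ fun i => t i y

/-- Every smooth function is, near `x`, a smooth function of finitely many members of `G`. -/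
def GeneratesAt (G : Set (SmoothFun X)) (x : X) : Prop := ∀ f, IsLocFun G x f

theorem isLocFun_of_eventuallyEq {G : Set (SmoothFun X)} {x : X} {f g : SmoothFun X} (hg : g ∈ G)
    (h : f.1 =ᶠ[𝓝 x] g.1) : IsLocFun G x f :=
  ⟨Unit, inferInstance, fun v => v (), fun _ => g, contDiff_apply ℝ ℝ (), fun _ => hg, h⟩

theorem GeneratesAt.trans {G G' : Set (SmoothFun X)} {x : X} (h : GeneratesAt G x)
    (h' : ∀ g ∈ G, IsLocFun G' x g) : GeneratesAt G' x := by
  intro f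
  obtain ⟨κ, _, φ, t, hφ, ht, e⟩ := h f
  choose ι hι ψ s hψ hs e' using fun i => h' (t i) (ht i)
  let _ := hι
  refine ⟨Σ i, ι i, inferInstance, fun v => φ fun i => ψ i fun j => v ⟨i, j⟩,
    fun p => s p.1 p.2, ?_, fun p => hs p.1 p.2, ?_⟩
  · exact hφ.comp (contDiff_pi.2 fun i => (hψ i).comp
      (contDiff_pi.2 fun j => contDiff_apply ℝ ℝ _))
  · filter_upwards [e, eventually_all.2 e'] with y hy hy'
    rw [hy]
    exact congrArg φ (funext hy')

theorem nhds_generate {A : Type u} (S : Set (A → ℝ)) (x : generate A S) :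
    𝓝 x = @nhds A (initialTop S) x := by
  change @nhds A (initialTop (genSet S)) x = _
  rw [initialTop_genSet]

/-- The topology of a differential space. -/
@[reducible] def topologicalSpace (X : DiffSpace.{u}) : TopologicalSpace X.carrier := inferInstance

theorem generatesAt_generate {A : Type u} {S : Set (A → ℝ)} {G : Set (SmoothFun (generate A S))}
    (hG : ∀ f : SmoothFun (generate A S), f.1 ∈ S → f ∈ G) (x : generate A S) :
    GeneratesAt G x := by
  intro f
  obtain ⟨κ, i, φ, t, hφ, ht, h⟩ := f.2 x
  rw [← nhds_generate] at h
  exact ⟨κ, i, φ, fun i => ⟨t i, subset_genSet _ (ht i)⟩, hφ, fun i => hG _ (ht i), h⟩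

theorem SMap.tendsto (F : SMap X Y) (x : X) : Tendsto F.toFun (𝓝 x) (𝓝 (F x)) :=
  F.continuous.continuousAt

theorem continuous_of_generate {A : Type u} {S : Set (A → ℝ)} {T : Type*} [TopologicalSpace T]
    {g : T → generate A S} (h : ∀ f ∈ S, Continuous fun t => f (g t)) : Continuous g := by
  have h' : @Continuous T A _ (initialTop S) g := continuous_initialTop h
  rw [← initialTop_genSet] at h'
  exact h'

/-- A set of smooth functions pulled back along a smooth map that extends functions locally. -/
theorem GeneratesAt.pull {G : Set (SmoothFun Y)} (i : SMap X Y) {x : X} (h : GeneratesAt G (i x))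
    (hi : ∀ g : SmoothFun X, ∃ f : SmoothFun Y, g.1 =ᶠ[𝓝 x] (i.pull f).1) :
    GeneratesAt (i.pull '' G) x := by
  intro g
  obtain ⟨f, hf⟩ := hi g
  obtain ⟨κ, _, φ, t, hφ, ht, e⟩ := h f
  exact ⟨κ, _, φ, fun j => i.pull (t j), hφ, fun j => ⟨_, ht j, rfl⟩,
    hf.trans ((i.tendsto x).eventually e)⟩

/-! ### Derivations along algebra homomorphisms -/

section Twisted

variable {L : Type*} [CommRing L] [IsDomain L] [Algebra ℝ L]

/-- `δ` is a derivation along the pair of homomorphisms `χ`, `χ'`. -/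
def IsTwisted (χ χ' : SmoothFun X → L) (δ : SmoothFun X →ₗ[ℝ] L) : Prop :=
  ∀ f g, δ (f * g) = χ f * δ g + χ' g * δ f

/-- A bump `b` at `x` with `b * (f - g) = 0` gives `χ b * δ (f - g) = 0` by the Leibniz rule, and
`L` is a domain. Two maps `χ`, `χ'` are allowed because the difference of two homomorphisms `χ - χ'`
is a derivation along the pair; uniqueness of jets and uniqueness of tangent vectors thus become one
statement. -/
theorem IsTwisted.local {χ χ' : SmoothFun X → L} {δ : SmoothFun X →ₗ[ℝ] L}
    (h : IsTwisted χ χ' δ) {x : X} (h1 : ∀ b : SmoothFun X, b x = 1 → χ b ≠ 0)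
    (h2 : ∀ f : SmoothFun X, f.1 =ᶠ[𝓝 x] 0 → χ' f = 0) {f g : SmoothFun X}
    (hfg : f.1 =ᶠ[𝓝 x] g.1) : δ f = δ g := by
  obtain ⟨b, hb1, hb0⟩ := exists_smooth_bump hfg
  have hz : b * (f - g) = 0 := by
    ext y
    by_cases hy : f.1 y = g.1 y
    · simp [hy]
    · simp [hb0 y hy]
  have h3 := h b (f - g)
  rw [hz, map_zero, h2 (f - g) (by
    filter_upwards [hfg] with y hy
    simp [hy]), zero_mul, add_zero] at h3
  have := (mul_eq_zero.1 h3.symm).resolve_left (h1 b hb1)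
  rwa [map_sub, sub_eq_zero] at this

theorem hom_local (χ : SmoothFun X →ₐ[ℝ] L) {x : X} (h1 : ∀ b : SmoothFun X, b x = 1 → χ b ≠ 0)
    {f g : SmoothFun X} (hfg : f.1 =ᶠ[𝓝 x] g.1) : χ f = χ g := by
  obtain ⟨b, hb1, hb0⟩ := exists_smooth_bump hfg
  have hz : b * (f - g) = 0 := by
    ext y
    by_cases hy : f.1 y = g.1 y
    · simp [hy]
    · simp [hb0 y hy]
  have h3 := congrArg χ hz
  rw [map_mul, map_zero] at h3
  have := (mul_eq_zero.1 h3).resolve_left (h1 b hb1)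
  rwa [map_sub, sub_eq_zero] at this

end Twisted

/-- Hadamard's lemma for a function given locally by generators. -/
theorem exists_hadamard {G : Set (SmoothFun X)} {x : X} {f : SmoothFun X} (h : IsLocFun G x f) :
    ∃ (κ : Type) (_ : Fintype κ) (t P : κ → SmoothFun X), (∀ i, t i ∈ G) ∧
      f.1 =ᶠ[𝓝 x] (algebraMap ℝ (SmoothFun X) (f x) +
        ∑ i, (t i - algebraMap ℝ (SmoothFun X) (t i x)) * P i).1 := by
  classical
  obtain ⟨κ, _, φ, t, hφ, ht, e⟩ := h
  obtain ⟨ψ, hψ, -, h⟩ := hadamard_lemma φ hφ (fun i => t i x)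
  refine ⟨κ, inferInstance, t, fun i => ⟨_, X.comp_mem (ψ i) (hψ i) (fun j => (t j).1)
    fun j => (t j).2⟩, ht, ?_⟩
  filter_upwards [e] with y hy
  have h1 : f x = φ fun i => t i x := e.self_of_nhds
  rw [hy, h, h1]
  simp

/-! ### Products -/

/-- The first projection. -/
def fstS (X : DiffSpace.{u}) (Y : DiffSpace.{v}) : SMap (X.prod Y) X where
  toFun p := Prod.fst p
  smooth' g hg := subset_genSet _ (Or.inl ⟨⟨g, hg⟩, rfl⟩)

/-- The second projection. -/
def sndS (X : DiffSpace.{u}) (Y : DiffSpace.{v}) : SMap (X.prod Y) Y where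
  toFun p := Prod.snd p
  smooth' g hg := subset_genSet _ (Or.inr ⟨⟨g, hg⟩, rfl⟩)

/-- The map into a product with given components. -/
def pairS (F : SMap Z X) (G : SMap Z Y) : SMap Z (X.prod Y) :=
  SMap.intoGenerate (fun z => (F z, G z)) (by
    rintro g (⟨f, rfl⟩ | ⟨f, rfl⟩)
    · exact (F.pull f).2
    · exact (G.pull f).2)

/-- Constant maps. -/
def constS (X : DiffSpace.{u}) (y : Y) : SMap X Y where
  toFun _ := y
  smooth' g _ := (algebraMap ℝ (SmoothFun X) (g y)).2

/-- The identity map. -/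
def idS (X : DiffSpace.{u}) : SMap X X := ⟨id, fun _ h => h⟩

theorem nhds_prodSpace (p : X.prod Y) : 𝓝 p = (𝓝 p.1 ×ˢ 𝓝 p.2 : Filter (X × Y)) := by
  rw [← nhds_prod_eq]
  refine congrArg (fun T => @nhds (X × Y) T p) (le_antisymm (continuous_id_iff_le.1 ?_)
    (continuous_id_iff_le.1 ?_) : topologicalSpace (X.prod Y) = instTopologicalSpaceProd)
  · exact continuous_prodMk.2 ⟨(fstS X Y).continuous, (sndS X Y).continuous⟩
  · refine continuous_of_generate (A := X × Y) ?_
    rintro g (⟨f, rfl⟩ | ⟨f, rfl⟩)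
    · exact (smoothFun_continuous f).comp continuous_fst
    · exact (smoothFun_continuous f).comp continuous_snd

theorem generatesAt_prod {G : Set (SmoothFun X)} {H : Set (SmoothFun Y)} (p : X.prod Y)
    (hG : GeneratesAt G p.1) (hH : GeneratesAt H p.2) :
    GeneratesAt ((fstS X Y).pull '' G ∪ (sndS X Y).pull '' H) p := by
  have h : GeneratesAt (range (fstS X Y).pull ∪ range (sndS X Y).pull) p := by
    apply generatesAt_generate
    rintro f (⟨g, hg⟩ | ⟨g, hg⟩)
    · exact Or.inl ⟨g, Subtype.ext hg.symm⟩
    · exact Or.inr ⟨g, Subtype.ext hg.symm⟩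
  refine h.trans ?_
  rintro f (⟨g, rfl⟩ | ⟨g, rfl⟩)
  · obtain ⟨κ, _, φ, t, hφ, ht, e⟩ := hG g
    exact ⟨κ, _, φ, fun i => (fstS X Y).pull (t i), hφ, fun i => Or.inl ⟨_, ht i, rfl⟩,
      ((fstS X Y).tendsto p).eventually e⟩
  · obtain ⟨κ, _, φ, t, hφ, ht, e⟩ := hH g
    exact ⟨κ, _, φ, fun i => (sndS X Y).pull (t i), hφ, fun i => Or.inr ⟨_, ht i, rfl⟩,
      ((sndS X Y).tendsto p).eventually e⟩

/-! ### Tangent vectors and vector fields -/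

@[ext]
theorem TangentVector.ext {x : X} {ξ ζ : TangentVector X x} (h : ∀ f, ξ f = ζ f) : ξ = ζ := by
  obtain ⟨a, _⟩ := ξ
  obtain ⟨b, _⟩ := ζ
  congr 1
  exact LinearMap.ext h

theorem TangentVector.isTwisted {x : X} (ξ : TangentVector X x) :
    IsTwisted (fun f : SmoothFun X => f x) (fun f => f x) ξ.toLinearMap := ξ.leibniz

theorem TangentVector.local {x : X} (ξ : TangentVector X x) {f g : SmoothFun X}
    (h : f.1 =ᶠ[𝓝 x] g.1) : ξ f = ξ g :=
  ξ.isTwisted.local (x := x) (fun b hb => by simp [hb]) (fun f hf => hf.self_of_nhds) h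

/-- The sum of tangent vectors. -/
instance (x : X) : Add (TangentVector X x) :=
  ⟨fun ξ ζ => ⟨ξ.toLinearMap + ζ.toLinearMap, fun f g => by
    simp only [LinearMap.add_apply, ξ.leibniz, ζ.leibniz]; ring⟩⟩

theorem TangentVector.add_apply {x : X} (ξ ζ : TangentVector X x) (f : SmoothFun X) :
    (ξ + ζ) f = ξ f + ζ f := rfl

theorem TangentVector.map_algebraMap {x : X} (ξ : TangentVector X x) (r : ℝ) :
    ξ (algebraMap ℝ (SmoothFun X) r) = 0 := by
  have h := ξ.leibniz 1 1
  simp only [mul_one] at h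
  have h1 : (1 : SmoothFun X) x = 1 := rfl
  rw [h1, one_mul] at h
  rw [Algebra.algebraMap_eq_smul_one, map_smul, show ξ.toLinearMap 1 = 0 by linarith, smul_zero]

/-- The chain rule for tangent vectors. -/
theorem TangentVector.chain {x : X} (ξ : TangentVector X x) {κ : Type} [Fintype κ] [DecidableEq κ]
    (φ : (κ → ℝ) → ℝ) (hφ : ContDiff ℝ ∞ φ) (t : κ → SmoothFun X) (g : SmoothFun X)
    (hg : g.1 =ᶠ[𝓝 x] fun y => φ fun i => t i y) :
    ξ g = ∑ i, fderiv ℝ φ (fun i => t i x) (Pi.single i 1) * ξ (t i) := by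
  obtain ⟨ψ, hψ, hψc, h⟩ := hadamard_lemma φ hφ (fun i => t i x)
  let P : κ → SmoothFun X := fun i => ⟨_, X.comp_mem (ψ i) (hψ i) (fun j => (t j).1) fun j => (t j).2⟩
  let k : SmoothFun X := algebraMap ℝ (SmoothFun X) (φ fun i => t i x) +
    ∑ i, (t i - algebraMap ℝ (SmoothFun X) (t i x)) * P i
  have hk : g.1 =ᶠ[𝓝 x] k.1 := by
    filter_upwards [hg] with y hy
    rw [hy, h]
    simp [k, P]
  rw [ξ.local hk]
  simp only [k, map_add, map_sum, ξ.leibniz, map_sub, ξ.map_algebraMap]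
  rw [zero_add]
  refine Finset.sum_congr rfl fun i _ => ?_
  have h1 : (t i - algebraMap ℝ (SmoothFun X) (t i x)) x = 0 := sub_self (t i x)
  have h2 : P i x = ψ i fun j => t j x := rfl
  rw [h1, h2, hψc]
  ring

/-- A family of tangent vectors which is smooth on generators is a vector field. -/
theorem exists_vectorField {G : Set (SmoothFun X)} (hG : ∀ x, GeneratesAt G x)
    (ξ : ∀ x, TangentVector X x) (h : ∀ g ∈ G, (fun x => ξ x g) ∈ X.smooth) :
    ∃ D : VectorField X, ∀ f x, D f x = ξ x f := by
  classical
  have hs : ∀ f : SmoothFun X, (fun x => ξ x f) ∈ X.smooth := by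
    intro f
    apply X.local_mem
    intro x
    obtain ⟨κ, _, φ, t, hφ, ht, e⟩ := hG x f
    -- The chain rule expresses `ξ y f` near `x` through the values on generators, which are smooth
    -- by assumption.
    let K : SmoothFun X := ∑ i, ⟨fun y => fderiv ℝ φ (fun j => t j y) (Pi.single i 1),
        X.comp_mem (fun v => fderiv ℝ φ v (Pi.single i 1))
        ((hφ.fderiv_right (m := ∞) (by simp)).clm_apply contDiff_const)
        (fun j => (t j).1) fun j => (t j).2⟩ * ⟨fun y => ξ y (t i), h _ (ht i)⟩
    have hK : ∀ y, K y = ∑ i, fderiv ℝ φ (fun j => t j y) (Pi.single i 1) * ξ y (t i) :=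
      fun y => by simp [K, Finset.sum_apply]
    refine ⟨K.1, K.2, ?_⟩
    -- The chain rule at `y` needs the local formula for `f` on a neighbourhood of `y`, not only at
    -- `y`.
    filter_upwards [eventually_eventually_nhds.2 e] with y hy
    rw [hK, (ξ y).chain φ hφ t f hy]
  refine ⟨Derivation.mk'
    { toFun := fun f => ⟨_, hs f⟩
      map_add' := fun f g => ?_
      map_smul' := fun r f => ?_ } fun f g => ?_, fun f x => rfl⟩
  · ext x
    exact map_add (ξ x).toLinearMap f g
  · ext x
    exact map_smul (ξ x).toLinearMap r f
  · ext x
    exact (ξ x).leibniz f g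

/-- Vector fields which agree on generators are equal. -/
theorem vectorField_ext {G : Set (SmoothFun X)} (hG : ∀ x, GeneratesAt G x) {D D' : VectorField X}
    (h : ∀ g ∈ G, D g = D' g) : D = D' := by
  classical
  refine Derivation.ext fun f => Subtype.ext (funext fun x => ?_)
  obtain ⟨κ, _, φ, t, hφ, ht, e⟩ := hG x f
  exact (derivation_chain D φ hφ t f x e).trans
    (Eq.trans (by simp only [fun i => h (t i) (ht i)]) (derivation_chain D' φ hφ t f x e).symm)

end Basic

/-! ### Open embeddings -/

section OpenEmb

variable {Q : DiffSpace.{u}} {W : DiffSpace.{v}} {Z : DiffSpace.{w}}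

/-- The inverse of a diffeomorphism. -/
def Diffeo.symm (e : Diffeo Q W) : Diffeo W Q := ⟨e.invSMap, e.toSMap, e.right_inv, e.left_inv⟩

/-- Diffeomorphisms onto open subspaces. -/
structure IsOpenEmb (i : SMap Q W) : Prop where
  injective : Function.Injective i.toFun
  isOpenMap : IsOpenMap i.toFun
  extend : ∀ (g : SmoothFun Q) (q : Q), ∃ f : SmoothFun W, g.1 =ᶠ[𝓝 q] (i.pull f).1

namespace IsOpenEmb

theorem eventually {i : SMap Q W} (hi : IsOpenEmb i) {q : Q} {P : W → Prop}
    (h : ∀ᶠ q' in 𝓝 q, P (i q')) : ∀ᶠ w in 𝓝 (i q), P w :=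
  hi.isOpenMap.nhds_le q h

theorem comp {j : SMap W Z} {i : SMap Q W} (hj : IsOpenEmb j) (hi : IsOpenEmb i) :
    IsOpenEmb (j.comp i) where
  injective := hj.injective.comp hi.injective
  isOpenMap := hj.isOpenMap.comp hi.isOpenMap
  extend g q := by
    obtain ⟨f, hf⟩ := hi.extend g q
    obtain ⟨f', hf'⟩ := hj.extend f (i q)
    exact ⟨f', hf.trans ((i.tendsto q).eventually hf')⟩

theorem inclusion {S : Set W} (hS : IsOpen S) : IsOpenEmb (PDEGeom.inclusion W S) where
  injective := Subtype.val_injective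
  isOpenMap := by
    rw [isOpenMap_iff_nhds_le]
    intro x
    change 𝓝 x.1 ≤ map (Subtype.val : S → W) (@nhds (W.sub S) _ x)
    rw [nhds_sub x, map_comap_setCoe_val]
    exact le_inf le_rfl (le_principal_iff.2 (hS.mem_nhds x.2))
  extend g q := exists_extension g q

theorem diffeo (e : Diffeo Q W) : IsOpenEmb e.toSMap where
  injective := Function.LeftInverse.injective e.left_inv
  isOpenMap := IsOpenMap.of_inverse e.invSMap.continuous e.right_inv e.left_inv
  extend g q := ⟨e.invSMap.pull g, Eventually.of_forall fun x => by
    change g.1 x = g.1 (e.invSMap (e.toSMap x))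
    rw [e.left_inv]⟩

/-- The image of an open embedding is diffeomorphic to its source. -/
theorem exists_diffeo {i : SMap Q W} (hi : IsOpenEmb i) :
    ∃ e : Diffeo (W.sub (range i.toFun)) Q, ∀ y, i (e.toSMap y) = y.1 := by
  have hr : ∀ y : range i.toFun, i (y.2.choose) = y.1 := fun y => y.2.choose_spec
  refine ⟨⟨⟨fun y => (y : range i.toFun).2.choose, fun g hg => ?_⟩,
    SMap.intoGenerate (fun q => (⟨i q, q, rfl⟩ : range i.toFun)) ?_, ?_, ?_⟩, hr⟩
  · apply (W.sub (range i.toFun)).local_mem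
    intro y
    obtain ⟨f, hf⟩ := hi.extend ⟨g, hg⟩ (y : range i.toFun).2.choose
    refine ⟨_, ((PDEGeom.inclusion W _).pull f).2, ?_⟩
    -- A local extension `f` of `g` agrees with `g` composed with the inverse on a neighbourhood in
    -- `W`, since `i` is open; injectivity makes the chosen preimage irrelevant.
    have h := ((PDEGeom.inclusion W (range i.toFun)).tendsto y).eventually
      (hr y ▸ hi.eventually (P := fun w => ∀ q, i q = w → g q = f w) (by
        filter_upwards [hf] with q hq q' hq'
        rw [hi.injective hq']
        exact hq))
    filter_upwards [h] with y' hy'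
    exact hy' _ (hr y')
  · rintro g ⟨f, rfl⟩
    exact (i.pull f).2
  · intro y
    exact Subtype.ext (hr y)
  · intro q
    exact hi.injective (hr ⟨i q, q, rfl⟩)

/-- This allows the fibre of a trivialization to be shrunk to a chart. A function on the product is
locally a function of finitely many functions on the factors, and these are extended one by one. -/
theorem prod_right (A : DiffSpace.{w}) {i : SMap Q W} (hi : IsOpenEmb i) :
    IsOpenEmb (pairS (fstS A Q) (i.comp (sndS A Q))) where
  injective := by
    intro p p' h
    have h1 : p.1 = p'.1 := congrArg (Prod.fst : A × W → A) h
    have h2 : i p.2 = i p'.2 := congrArg (Prod.snd : A × W → W) h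
    exact Prod.ext h1 (hi.injective h2)
  isOpenMap := by
    rw [isOpenMap_iff_nhds_le]
    intro p
    rw [nhds_prodSpace, nhds_prodSpace]
    change _ ≤ map (Prod.map id i.toFun) _
    rw [← prod_map_map_eq', map_id]
    exact Filter.prod_mono le_rfl (hi.isOpenMap.nhds_le _)
  extend g p := by
    have h := (generatesAt_prod (G := univ) (H := univ) p
      (fun f => isLocFun_of_eventuallyEq (mem_univ f) EventuallyEq.rfl)
      (fun f => isLocFun_of_eventuallyEq (mem_univ f) EventuallyEq.rfl)) g
    obtain ⟨κ, _, φ, t, hφ, ht, e⟩ := h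
    have : ∀ j, ∃ f : SmoothFun (A.prod W), (t j).1 =ᶠ[𝓝 p]
        ((pairS (fstS A Q) (i.comp (sndS A Q))).pull f).1 := by
      intro j
      obtain ⟨a, -, ha⟩ | ⟨b, -, hb⟩ := ht j
      · exact ⟨(fstS A W).pull a, by rw [← ha]; rfl⟩
      · obtain ⟨f, hf⟩ := hi.extend b p.2
        exact ⟨(sndS A W).pull f, by rw [← hb]; exact ((sndS A Q).tendsto p).eventually hf⟩
    choose f hf using this
    refine ⟨⟨_, (A.prod W).comp_mem φ hφ (fun j => (f j).1) fun j => (f j).2⟩, ?_⟩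
    filter_upwards [e, eventually_all.2 hf] with x hx hx'
    rw [hx]
    exact congrArg φ (funext hx')

/-- A linear map which depends on germs at `i q` only is defined on functions near `q`. -/
theorem exists_lift {i : SMap Q W} (hi : IsOpenEmb i) (q : Q) {L : Type*} [AddCommGroup L]
    [Module ℝ L] (Λ : SmoothFun W →ₗ[ℝ] L)
    (hΛ : ∀ f g : SmoothFun W, f.1 =ᶠ[𝓝 (i q)] g.1 → Λ f = Λ g) :
    ∃ Λ' : SmoothFun Q →ₗ[ℝ] L, ∀ (g : SmoothFun Q) (f : SmoothFun W),
      g.1 =ᶠ[𝓝 q] (i.pull f).1 → Λ' g = Λ f := by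
  choose E hE using fun g => hi.extend g q
  -- The value does not depend on the extension, because two extensions of `g` have the same germ at
  -- `i q`. Linearity follows by choosing convenient extensions.
  have key : ∀ (g : SmoothFun Q) (f : SmoothFun W), g.1 =ᶠ[𝓝 q] (i.pull f).1 → Λ (E g) = Λ f :=
    fun g f h => hΛ _ _ (hi.eventually ((hE g).symm.trans h))
  refine ⟨⟨⟨fun g => Λ (E g), fun g h => ?_⟩, fun r g => ?_⟩, key⟩
  · rw [← map_add]
    exact key _ _ ((hE g).add (hE h))
  · rw [RingHom.id_apply, ← map_smul]
    exact key _ _ ((hE g).const_smul r)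

/-- Tangent vectors depend on germs only, so they pass to the source of an open embedding. The base
point is given by an equation because in the applications `i q` and `w` agree only propositionally.
-/
theorem exists_lift_tangent {i : SMap Q W} (hi : IsOpenEmb i) {q : Q} {w : W} (hw : i q = w)
    (ξ : TangentVector W w) : ∃ ζ : TangentVector Q q, ∀ f, ζ (i.pull f) = ξ f := by
  subst hw
  obtain ⟨Λ, h⟩ := hi.exists_lift q ξ.toLinearMap fun f g e => ξ.local e
  refine ⟨⟨Λ, fun f g => ?_⟩, fun f => h _ _ EventuallyEq.rfl⟩
  obtain ⟨f', hf⟩ := hi.extend f q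
  obtain ⟨g', hg⟩ := hi.extend g q
  rw [h f f' hf, h g g' hg, h (f * g) (f' * g') (by rw [map_mul]; exact hf.mul hg), ξ.leibniz,
    show f q = f' (i q) from hf.self_of_nhds, show g q = g' (i q) from hg.self_of_nhds]

end IsOpenEmb

end OpenEmb

open PowerSeries

/-! ### Uniqueness of derivations with values in power series -/

section Series

variable {X : DiffSpace.{u}} {x : X}

/-- `χ` is a family of power series centred at the point `x`. -/
def IsCentred (χ : SmoothFun X →ₐ[ℝ] ℝ⟦X⟧) (x : X) : Prop := ∀ f, constantCoeff (χ f) = f x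

theorem IsCentred.ne_zero {χ : SmoothFun X →ₐ[ℝ] ℝ⟦X⟧} (h : IsCentred χ x) (b : SmoothFun X)
    (hb : b x = 1) : χ b ≠ 0 := by
  intro h0
  have := h b
  rw [h0, hb] at this
  simp at this

theorem IsCentred.congr {χ : SmoothFun X →ₐ[ℝ] ℝ⟦X⟧} (h : IsCentred χ x) {f g : SmoothFun X}
    (hfg : f.1 =ᶠ[𝓝 x] g.1) : χ f = χ g :=
  hom_local χ h.ne_zero hfg

theorem IsTwisted.congr {χ χ' : SmoothFun X →ₐ[ℝ] ℝ⟦X⟧} (h : IsCentred χ x)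
    (h' : IsCentred χ' x) {δ : SmoothFun X →ₗ[ℝ] ℝ⟦X⟧} (hδ : IsTwisted χ χ' δ) {f g : SmoothFun X}
    (hfg : f.1 =ᶠ[𝓝 x] g.1) : δ f = δ g :=
  hδ.local (x := x) h.ne_zero (fun f hf => by
    rw [h'.congr (g := 0) hf, map_zero]) hfg

theorem IsTwisted.map_algebraMap {χ χ' : SmoothFun X →ₐ[ℝ] ℝ⟦X⟧}
    {δ : SmoothFun X →ₗ[ℝ] ℝ⟦X⟧} (hδ : IsTwisted χ χ' δ) (r : ℝ) :
    δ (algebraMap ℝ (SmoothFun X) r) = 0 := by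
  have h := hδ 1 1
  simp only [mul_one, map_one, one_mul] at h
  rw [Algebra.algebraMap_eq_smul_one, map_smul, show δ 1 = 0 by simpa using h, smul_zero]

/-- A derivation with values in power series vanishes if it vanishes on local generators; here the
vanishing of a coefficient may be proved under the assumption that all lower ones vanish. -/
theorem IsTwisted.eq_zero {χ χ' : SmoothFun X →ₐ[ℝ] ℝ⟦X⟧} (h : IsCentred χ x)
    (h' : IsCentred χ' x) {δ : SmoothFun X →ₗ[ℝ] ℝ⟦X⟧} (hδ : IsTwisted χ χ' δ)
    {G : Set (SmoothFun X)} (hG : GeneratesAt G x)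
    (hn : ∀ n, (∀ f, (PowerSeries.X : ℝ⟦X⟧) ^ n ∣ δ f) → ∀ g ∈ G, coeff n (δ g) = 0) : δ = 0 := by
  have key : ∀ n f, (PowerSeries.X : ℝ⟦X⟧) ^ n ∣ δ f := by
    intro n
    induction n with
    | zero => intro f; simp
    | succ n ih =>
      have hg : ∀ g ∈ G, (PowerSeries.X : ℝ⟦X⟧) ^ (n + 1) ∣ δ g := by
        intro g hg
        rw [X_pow_dvd_iff]
        intro m hm
        obtain hm | rfl := Nat.lt_succ_iff_lt_or_eq.1 hm
        · exact X_pow_dvd_iff.1 (ih g) m hm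
        · exact hn m ih g hg
      intro f
      -- Near `x`, `f = f x + ∑ (t i - t i x) * P i`. In the Leibniz expansion one term contains `χ
      -- (t i - t i x) * δ (P i)`, the other contains `δ (t i)`, which is controlled since `t i` is
      -- a generator.
      obtain ⟨κ, _, t, P, ht, e⟩ := exists_hadamard (hG f)
      rw [hδ.congr h h' e, map_add, hδ.map_algebraMap, zero_add, map_sum]
      refine Finset.dvd_sum fun i _ => ?_
      rw [hδ]
      refine dvd_add ?_ (Dvd.dvd.mul_left ?_ _)
      -- The series `χ (t i - t i x)` has zero constant term and supplies the additional power of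
      -- the variable.
      · rw [pow_succ']
        refine mul_dvd_mul ?_ (ih _)
        rw [X_dvd_iff, h]
        exact sub_self (t i x)
      · rw [map_sub, hδ.map_algebraMap, sub_zero]
        exact hg _ (ht i)
  ext f n
  exact X_pow_dvd_iff.1 (key (n + 1) f) n (Nat.lt_succ_self n)

end Series

/-! ### Jets of curves subject to differential relations -/

/-- Infinite jets of curves in `W`, given as homomorphisms `f ↦ f(γ(t))`, which satisfy
`d a(γ(t))/dt = b(γ(t))` for all `(a, b)` in `R`. -/
@[ext]
structure CurveJet (W : DiffSpace.{w}) (R : Set (SmoothFun W × SmoothFun W)) where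
  pt : W
  hom : SmoothFun W →ₐ[ℝ] ℝ⟦X⟧
  centred : IsCentred hom pt
  rel : ∀ p ∈ R, d⁄dX ℝ (hom p.1) = hom p.2

/-- The differential space of jets of curves; its smooth functions are generated by the Taylor
coefficients of smooth functions along the curve. -/
def CurveJets (W : DiffSpace.{w}) (R : Set (SmoothFun W × SmoothFun W)) : DiffSpace.{w} :=
  generate (CurveJet W R) {g | ∃ n f, g = fun χ => coeff n (χ.hom f)}

namespace CurveJets

section

variable {W : DiffSpace.{w}} {R : Set (SmoothFun W × SmoothFun W)}

/-- The point of a jet. -/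
def pt (χ : CurveJets W R) : W := CurveJet.pt χ

/-- The Taylor expansion of functions along a jet. -/
def hom (χ : CurveJets W R) : SmoothFun W →ₐ[ℝ] ℝ⟦X⟧ := CurveJet.hom χ

theorem centred (χ : CurveJets W R) : IsCentred (hom χ) (pt χ) := CurveJet.centred χ

theorem rel (χ : CurveJets W R) : ∀ p ∈ R, d⁄dX ℝ (hom χ p.1) = hom χ p.2 := CurveJet.rel χ

/-- The Taylor coefficients. -/
def coeffFun (n : ℕ) (f : SmoothFun W) : SmoothFun (CurveJets W R) :=
  ⟨fun χ => coeff n (hom χ f), subset_genSet _ ⟨n, f, rfl⟩⟩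

variable (W R) in
/-- The generators. -/
def gens : Set (SmoothFun (CurveJets W R)) := {g | ∃ n f, g = coeffFun n f}

theorem generatesAt (χ : CurveJets W R) : GeneratesAt (gens W R) χ :=
  generatesAt_generate (G := gens W R) (by
    rintro g ⟨n, f, h⟩
    exact ⟨n, f, Subtype.ext h⟩) χ

variable (W R) in
/-- The projection to `W`. -/
def proj : SMap (CurveJets W R) W where
  toFun := pt
  smooth' g hg := by
    refine subset_genSet _ ⟨0, ⟨g, hg⟩, funext fun χ => ?_⟩
    rw [coeff_zero_eq_constantCoeff]
    exact (centred χ ⟨g, hg⟩).symm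

theorem proj_pull (f : SmoothFun W) : (proj W R).pull f = coeffFun 0 f := by
  refine Subtype.ext (funext fun χ => ?_)
  change f (pt χ) = coeff 0 (hom χ f)
  rw [coeff_zero_eq_constantCoeff]
  exact (centred χ f).symm

theorem ext' {χ χ' : CurveJets W R} (h : pt χ = pt χ') (h' : hom χ = hom χ') : χ = χ' :=
  CurveJet.ext h h'

/-- Jets are determined by their coefficients on local generators. -/
theorem eq_of_generators {χ χ' : CurveJets W R} (h : pt χ = pt χ') {G : Set (SmoothFun W)}
    (hG : GeneratesAt G (pt χ))
    (hn : ∀ n, (∀ f, (PowerSeries.X : ℝ⟦X⟧) ^ n ∣ hom χ f - hom χ' f) →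
      ∀ g ∈ G, coeff n (hom χ g) = coeff n (hom χ' g)) : χ = χ' := by
  refine ext' h (AlgHom.toLinearMap_injective (sub_eq_zero.1 ?_))
  -- The difference of the two homomorphisms is a derivation along the pair `hom χ`, `hom χ'`.
  refine IsTwisted.eq_zero (centred χ) (h ▸ centred χ') (fun f g => ?_) hG
    fun n hn' g hg => ?_
  · simp only [LinearMap.sub_apply, AlgHom.toLinearMap_apply, map_mul]
    ring
  · simp [hn n hn' g hg]

/-- A map into the space of jets is smooth if all Taylor coefficients are. -/
def mkS {Z : DiffSpace.{v}} (F : Z → CurveJet W R)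
    (h : ∀ n f, (fun z => coeff n ((F z).hom f)) ∈ Z.smooth) : SMap Z (CurveJets W R) :=
  SMap.intoGenerate F (by
    rintro g ⟨n, f, rfl⟩
    exact h n f)

/-! ### The flow of a vector field -/

/-- The Taylor expansion of a function along the trajectories of a vector field. -/
def expSeries {Z : DiffSpace.{v}} (S : VectorField Z) (z : Z) (f : SmoothFun Z) : ℝ⟦X⟧ :=
  PowerSeries.mk fun n => (n.factorial : ℝ)⁻¹ * (S^[n] f) z

theorem derivative_expSeries {Z : DiffSpace.{v}} (S : VectorField Z) (z : Z) (f : SmoothFun Z) :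
    d⁄dX ℝ (expSeries S z f) = expSeries S z (S f) := by
  ext n
  rw [coeff_derivative, expSeries, expSeries, coeff_mk, coeff_mk, Nat.factorial_succ,
    Function.iterate_succ_apply]
  push_cast
  have : (n.factorial : ℝ) ≠ 0 := by positivity
  field_simp

theorem constantCoeff_expSeries {Z : DiffSpace.{v}} (S : VectorField Z) (z : Z) (f : SmoothFun Z) :
    constantCoeff (expSeries S z f) = f z := by
  rw [← coeff_zero_eq_constantCoeff_apply, expSeries, coeff_mk]
  simp

/-- Coefficients of a power series vanish with those of its derivative. -/
theorem coeff_succ_eq_zero {φ : ℝ⟦X⟧} {n : ℕ} (h : coeff n (d⁄dX ℝ φ) = 0) :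
    coeff (n + 1) φ = 0 := by
  rw [coeff_derivative] at h
  exact (mul_eq_zero.1 h).resolve_right (by positivity)

/-- The Taylor expansion along trajectories, as a homomorphism of algebras. -/
def expHom {Z : DiffSpace.{v}} (S : VectorField Z) (z : Z) : SmoothFun Z →ₐ[ℝ] ℝ⟦X⟧ :=
  AlgHom.ofLinearMap
    { toFun := expSeries S z
      map_add' := fun f g => by
        ext n
        simp only [expSeries, coeff_mk, map_add, iterate_map_add]
        exact mul_add _ _ _
      map_smul' := fun r f => by
        ext n
        have h : ∀ f, S^[n] (r • f) = r • S^[n] f := by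
          induction n with
          | zero => intro f; rfl
          | succ n ih =>
            intro f
            rw [Function.iterate_succ_apply, Function.iterate_succ_apply, S.map_smul, ih]
        simp only [expSeries, coeff_mk, h, RingHom.id_apply, map_smul, smul_eq_mul]
        change _ * (r * _) = _
        ring }
    (by
      ext n
      cases n with
      | zero =>
        change coeff 0 (expSeries S z 1) = _
        rw [coeff_zero_eq_constantCoeff_apply, constantCoeff_expSeries]
        simp
      | succ n =>
        change coeff (n + 1) (expSeries S z 1) = _
        rw [coeff_succ_eq_zero (φ := expSeries S z 1), coeff_one, if_neg n.succ_ne_zero]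
        rw [derivative_expSeries, Derivation.map_one_eq_zero]
        simp only [expSeries, coeff_mk, iterate_map_zero]
        exact mul_zero _)
    (by
      have hadd : ∀ f g, expSeries S z (f + g) = expSeries S z f + expSeries S z g := by
        intro f g
        ext n
        simp only [expSeries, coeff_mk, map_add, iterate_map_add]
        exact mul_add _ _ _
      intro f g
      change expSeries S z (f * g) = expSeries S z f * expSeries S z g
      ext n
      induction n generalizing f g with
      | zero =>
        simp only [coeff_zero_eq_constantCoeff_apply, map_mul, constantCoeff_expSeries]
        rfl
      | succ n ih =>
        -- The two sides have the same derivative up to order `n`: `d/dt` turns `expSeries S z f`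
        -- into `expSeries S z (S f)`, the Leibniz rule holds for `S` and for `d/dt`, and the
        -- induction hypothesis applies to the pairs `(f, S g)` and `(g, S f)`.
        rw [← sub_eq_zero, ← map_sub]
        apply coeff_succ_eq_zero
        rw [map_sub, Derivation.leibniz, derivative_expSeries, derivative_expSeries,
          derivative_expSeries, Derivation.leibniz, hadd, smul_eq_mul, smul_eq_mul, smul_eq_mul,
          smul_eq_mul]
        simp only [map_sub, map_add, ih, sub_self])

theorem coeff_expHom {Z : DiffSpace.{v}} (S : VectorField Z) (z : Z) (f : SmoothFun Z) (n : ℕ) :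
    coeff n (expHom S z f) = (n.factorial : ℝ)⁻¹ * (S^[n] f) z := by
  change coeff n (expSeries S z f) = _
  rw [expSeries, coeff_mk]

/-- The map `Z → CurveJets W R` which takes `z` to the jet of the image of the trajectory of `S`. -/
def flow {Z : DiffSpace.{v}} (S : VectorField Z) (p : SMap Z W)
    (h : ∀ q ∈ R, S (p.pull q.1) = p.pull q.2) : SMap Z (CurveJets W R) :=
  mkS (fun z => ⟨p z, (expHom S z).comp p.pull, fun _ => constantCoeff_expSeries S z _,
    fun q hq => by
      change d⁄dX ℝ (expSeries S z (p.pull q.1)) = expSeries S z (p.pull q.2)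
      rw [derivative_expSeries, h q hq]⟩)
    (fun n f => by
      have : (fun z => coeff n ((expHom S z).comp p.pull f)) =
          ((n.factorial : ℝ)⁻¹ • S^[n] (p.pull f)).1 := funext fun z => coeff_expHom S z _ n
      exact this ▸ Subtype.property _)

theorem hom_flow {Z : DiffSpace.{v}} (S : VectorField Z) (p : SMap Z W)
    (h : ∀ q ∈ R, S (p.pull q.1) = p.pull q.2) (z : Z) (f : SmoothFun W) :
    hom (flow S p h z) f = expSeries S z (p.pull f) := rfl

end

/-! ### Functoriality -/

section Map

variable {Q : DiffSpace.{u}} {W : DiffSpace.{w}} {R : Set (SmoothFun W × SmoothFun W)}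
  {R' : Set (SmoothFun Q × SmoothFun Q)}

/-- The map of jets induced by a smooth map. -/
def map (i : SMap Q W) (h : ∀ p ∈ R, (i.pull p.1, i.pull p.2) ∈ R') :
    SMap (CurveJets Q R') (CurveJets W R) :=
  mkS (fun χ => ⟨i (pt χ), (hom χ).comp i.pull, fun _ => centred χ _, fun p hp => rel χ _ (h p hp)⟩)
    (fun n f => (coeffFun (R := R') n (i.pull f)).2)

theorem hom_map (i : SMap Q W) (h : ∀ p ∈ R, (i.pull p.1, i.pull p.2) ∈ R') (χ : CurveJets Q R')
    (f : SmoothFun W) : hom (map i h χ) f = hom χ (i.pull f) := rfl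

/-- Jets lift along open embeddings. -/
theorem exists_lift {i : SMap Q W} (hi : IsOpenEmb i)
    (h' : ∀ p' ∈ R', ∃ p ∈ R, (i.pull p.1, i.pull p.2) = p') (χ : CurveJets W R)
    {q : Q} (hq : i q = pt χ) : ∃ χ' : CurveJets Q R', pt χ' = q ∧
      ∀ (g : SmoothFun Q) (f : SmoothFun W), g.1 =ᶠ[𝓝 q] (i.pull f).1 → hom χ' g = hom χ f := by
  have hc : IsCentred (hom χ) (i q) := hq ▸ centred χ
  obtain ⟨Λ, h⟩ := hi.exists_lift q (hom χ).toLinearMap fun _ _ e => hc.congr e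
  have h1 : Λ 1 = 1 := by rw [h 1 1 EventuallyEq.rfl]; exact map_one (hom χ)
  have hm : ∀ f g, Λ (f * g) = Λ f * Λ g := by
    intro f g
    obtain ⟨f', hf⟩ := hi.extend f q
    obtain ⟨g', hg⟩ := hi.extend g q
    rw [h f f' hf, h g g' hg, h (f * g) (f' * g') (by rw [map_mul]; exact hf.mul hg)]
    exact map_mul (hom χ) f' g'
  refine ⟨(⟨q, AlgHom.ofLinearMap Λ h1 hm, fun g => ?_, fun p' hp => ?_⟩ : CurveJet Q R'), rfl, h⟩
  · obtain ⟨f, hf⟩ := hi.extend g q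
    change constantCoeff (Λ g) = g q
    rw [h g f hf, show g q = f (i q) from hf.self_of_nhds]
    exact hc f
  · obtain ⟨p, hpR, rfl⟩ := h' p' hp
    change d⁄dX ℝ (Λ (i.pull p.1)) = Λ (i.pull p.2)
    rw [h _ p.1 EventuallyEq.rfl, h _ p.2 EventuallyEq.rfl]
    exact rel χ p hpR

variable {i : SMap Q W} (hi : IsOpenEmb i) (h : ∀ p ∈ R, (i.pull p.1, i.pull p.2) ∈ R')
  (h' : ∀ p' ∈ R', ∃ p ∈ R, (i.pull p.1, i.pull p.2) = p')

include hi

theorem map_injective : Function.Injective (map i h).toFun := by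
  intro χ χ' e
  have hp : pt χ = pt χ' := hi.injective (congrArg pt e)
  refine ext' hp (AlgHom.ext fun g => ?_)
  obtain ⟨f, hf⟩ := hi.extend g (pt χ)
  rw [(centred χ).congr hf, ((hp ▸ centred χ' : IsCentred (hom χ') (pt χ))).congr hf, ← hom_map i h, ← hom_map i h]
  exact congrArg (fun χ => hom χ f) e

include h'

/-- A jet depends only on germs at its point, so every jet in `W` centred in the image of `i` lifts.
The hypothesis `h'` ensures that no relations are imposed on `Q` beyond those pulled back from `W`.
-/
theorem range_map : range (map i h).toFun = {χ | pt χ ∈ range i.toFun} := by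
  ext χ
  constructor
  · rintro ⟨χ', rfl⟩
    exact ⟨pt χ', rfl⟩
  · rintro ⟨q, hq⟩
    obtain ⟨χ', hp, hχ⟩ := exists_lift hi h' χ hq
    refine ⟨χ', ext' ((congrArg i.toFun hp).trans hq) (AlgHom.ext fun f => ?_)⟩
    exact hχ _ _ EventuallyEq.rfl

/-- The jets centred in the open image of `i` form an open set, and the inverse defined there is
continuous: near a given jet, the Taylor coefficients of `g` are those of a local extension `f` of
`g`. Extending the coefficients in this way also extends smooth functions. -/
theorem isOpenEmb_map : IsOpenEmb (map i h) where
  injective := map_injective hi h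
  isOpenMap := by
    have hO : IsOpen {χ : CurveJets W R | pt χ ∈ range i.toFun} :=
      hi.isOpenMap.isOpen_range.preimage (proj W R).continuous
    have hr : ∀ χ : {χ : CurveJets W R | pt χ ∈ range i.toFun}, ∃ χ', map i h χ' = χ.1 := by
      intro χ
      exact (range_map hi h h').ge χ.2
    choose r hr using hr
    have hrc : Continuous r := by
      refine continuous_of_generate ?_
      rintro _ ⟨n, g, rfl⟩
      rw [continuous_iff_continuousAt]
      intro χ
      obtain ⟨f, hf⟩ := hi.extend g (pt (r χ))
      have hc : Continuous fun χ : {χ : CurveJets W R | pt χ ∈ range i.toFun} =>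
        coeff n (hom χ.1 f) := (smoothFun_continuous (coeffFun n f)).comp continuous_subtype_val
      refine hc.continuousAt.congr ?_
      have h1 : i (pt (r χ)) = pt χ.1 := congrArg pt (hr χ)
      -- An extension of `g` near one point is an extension near all neighbouring points, so that
      -- one `f` serves for all jets close to `χ`.
      have h2 := hi.eventually (P := fun w => ∀ q, i q = w → g.1 =ᶠ[𝓝 q] (i.pull f).1) (by
        filter_upwards [eventually_eventually_nhds.2 hf] with q hq q' hq'
        rw [hi.injective hq']
        exact hq)
      rw [h1] at h2
      have h3 := (((proj W R).continuous.comp continuous_subtype_val).tendsto χ).eventually h2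
      filter_upwards [h3] with χ' hχ'
      have h4 : i (pt (r χ')) = pt χ'.1 := congrArg pt (hr χ')
      change _ = coeff n (hom (r χ') g)
      rw [(centred (r χ')).congr (hχ' _ h4), ← hom_map i h, hr]
    intro U hU
    have : (map i h).toFun '' U = Subtype.val '' (r ⁻¹' U) := by
      ext χ
      constructor
      · rintro ⟨χ', hχ', rfl⟩
        refine ⟨⟨map i h χ', pt χ', rfl⟩, ?_, rfl⟩
        rw [mem_preimage, map_injective hi h (hr ⟨map i h χ', pt χ', rfl⟩)]
        exact hχ'
      · rintro ⟨χ', hχ', rfl⟩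
        exact ⟨r χ', hχ', hr χ'⟩
    rw [this]
    exact hO.isOpenMap_subtype_val _ (hU.preimage hrc)
  extend g χ := by
    have hl : GeneratesAt (gens Q R') χ := generatesAt χ
    obtain ⟨κ, _, φ, t, hφ, ht, e⟩ := hl g
    have : ∀ j, ∃ f : SmoothFun (CurveJets W R), (t j).1 =ᶠ[𝓝 χ] ((map i h).pull f).1 := by
      intro j
      obtain ⟨n, g, hg⟩ := ht j
      obtain ⟨f, hf⟩ := hi.extend g (pt χ)
      refine ⟨coeffFun n f, ?_⟩
      filter_upwards [((proj Q R').tendsto χ).eventually (eventually_eventually_nhds.2 hf)] with χ' hχ'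
      rw [hg]
      exact congrArg (coeff n) ((centred χ').congr hχ')
    choose f hf using this
    refine ⟨⟨_, (CurveJets W R).comp_mem φ hφ (fun j => (f j).1) fun j => (f j).2⟩, ?_⟩
    filter_upwards [e, eventually_all.2 hf] with x hx hx'
    rw [hx]
    exact congrArg φ (funext hx')

end Map

end CurveJets

/-! ### Maps into subspaces and coordinate spaces -/

section Coord

variable {X : DiffSpace.{u}} {Z : DiffSpace.{v}}

/-- A smooth map with values in a subset. -/
def intoSub {S : Set X} (F : SMap Z X) (h : ∀ z, F z ∈ S) : SMap Z (X.sub S) :=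
  SMap.intoGenerate (fun z => (⟨F z, h z⟩ : S)) (by
    rintro g ⟨f, rfl⟩
    exact (F.pull f).2)

/-- The coordinate functions. -/
def coordS {ι : Type} (i : ι) : SmoothFun (coordSpace ι) := ⟨fun v => v i, subset_genSet _ ⟨i, rfl⟩⟩

/-- The map with given coordinates. -/
def intoCoord {ι : Type} (t : ι → SmoothFun Z) : SMap Z (coordSpace ι) :=
  SMap.intoGenerate (fun z i => t i z) (by
    rintro g ⟨i, rfl⟩
    exact (t i).2)

theorem generatesAt_coord {ι : Type} (v : coordSpace ι) : GeneratesAt (range coordS) v :=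
  generatesAt_generate (G := range coordS) (by
    rintro f ⟨i, hi⟩
    exact ⟨i, Subtype.ext hi.symm⟩) v

theorem generatesAt_sub {S : Set X} {G : Set (SmoothFun X)} (x : X.sub S) (h : GeneratesAt G x.1) :
    GeneratesAt ((inclusion X S).pull '' G) x :=
  GeneratesAt.pull (inclusion X S) h fun g => exists_extension g x

/-- Lines in coordinate spaces. -/
def line {ι : Type} (v a : ι → ℝ) (ε : ℝ) : coordSpace ι := fun i : ι => v i + ε * a i

theorem line_zero {ι : Type} (v a : ι → ℝ) : line v a 0 = v :=
  funext fun i => by simp [line]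

theorem continuous_line {ι : Type} (v a : ι → ℝ) : Continuous (line v a) := by
  refine continuous_of_generate ?_
  rintro _ ⟨i, rfl⟩
  change Continuous fun ε : ℝ => v i + ε * a i
  fun_prop

theorem differentiableAt_line {ι : Type} (v a : ι → ℝ) (f : SmoothFun (coordSpace ι)) :
    DifferentiableAt ℝ (fun ε : ℝ => f (line v a ε)) 0 := by
  obtain ⟨κ, _, φ, t, hφ, ht, e⟩ := generatesAt_coord (line v a 0) f
  choose j hj using ht
  have h2 : (fun ε : ℝ => f (line v a ε)) =ᶠ[𝓝 0] fun ε => φ fun i => v (j i) + ε * a (j i) := by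
    filter_upwards [((continuous_line v a).tendsto 0).eventually e] with ε hε
    rw [hε]
    simp only [← hj]
    rfl
  refine DifferentiableAt.congr_of_eventuallyEq ?_ h2
  exact (hφ.differentiable (by simp) _).comp 0 (by fun_prop)

/-- Tangent vectors of coordinate spaces with given components. -/
theorem exists_tangent_coord {ι : Type} (v : coordSpace ι) (a : ι → ℝ) :
    ∃ ξ : TangentVector (coordSpace ι) v, ∀ i, ξ (coordS i) = a i := by
  have h0 : line v a 0 = v := line_zero v a
  -- The derivative along the line through `v` in direction `a`. It exists for infinitely many
  -- nonzero `a i` too, as a smooth function depends near `v` on finitely many coordinates.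
  refine ⟨⟨⟨⟨fun f => deriv (fun ε : ℝ => f (line v a ε)) 0, fun f g => ?_⟩,
    fun r f => ?_⟩, fun f g => ?_⟩, fun i => ?_⟩
  · exact deriv_add (differentiableAt_line v a f) (differentiableAt_line v a g)
  · exact deriv_const_mul r (differentiableAt_line v a f)
  · have h := deriv_mul (differentiableAt_line v a f) (differentiableAt_line v a g)
    refine h.trans ?_
    change _ = f v * deriv _ 0 + g v * deriv _ 0
    rw [h0]
    ring
  · change deriv (fun ε : ℝ => v i + ε * a i) 0 = a i
    simp

end Coord

namespace CurveJets

/-! ### Tangent vectors of spaces of jets -/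

section Tangent

variable {W : DiffSpace.{w}} {R : Set (SmoothFun W × SmoothFun W)}

theorem coeffFun_mul (n : ℕ) (f g : SmoothFun W) : coeffFun (R := R) n (f * g) =
    ∑ p ∈ Finset.HasAntidiagonal.antidiagonal n, coeffFun p.1 f * coeffFun p.2 g := by
  refine Subtype.ext (funext fun χ => ?_)
  change coeff n (hom χ (f * g)) = _
  rw [map_mul, coeff_mul]
  simp [coeffFun]

theorem coeffFun_add (n : ℕ) (f g : SmoothFun W) :
    coeffFun (R := R) n (f + g) = coeffFun n f + coeffFun n g := by
  refine Subtype.ext (funext fun χ => ?_)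
  change coeff n (hom χ (f + g)) = coeff n (hom χ f) + coeff n (hom χ g)
  simp

theorem coeffFun_sub (n : ℕ) (f g : SmoothFun W) :
    coeffFun (R := R) n (f - g) = coeffFun n f - coeffFun n g := by
  refine Subtype.ext (funext fun χ => ?_)
  change coeff n (hom χ (f - g)) = coeff n (hom χ f) - coeff n (hom χ g)
  simp

theorem coeffFun_smul (n : ℕ) (r : ℝ) (f : SmoothFun W) :
    coeffFun (R := R) n (r • f) = r • coeffFun n f := by
  refine Subtype.ext (funext fun χ => ?_)
  change coeff n (hom χ (r • f)) = r * coeff n (hom χ f)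
  simp

/-- These identities between Taylor coefficients are the reason why the values of a tangent vector
on them cannot be prescribed freely. -/
theorem coeffFun_rel (n : ℕ) {p : SmoothFun W × SmoothFun W} (hp : p ∈ R) :
    coeffFun (R := R) n p.2 = ((n : ℝ) + 1) • coeffFun (n + 1) p.1 := by
  refine Subtype.ext (funext fun χ => ?_)
  change coeff n (hom χ p.2) = ((n : ℝ) + 1) * coeff (n + 1) (hom χ p.1)
  rw [← rel χ p hp, coeff_derivative, mul_comm]

/-- The derivation over `χ` given by a tangent vector. -/
def series {χ : CurveJets W R} (ξ : TangentVector (CurveJets W R) χ) : SmoothFun W →ₗ[ℝ] ℝ⟦X⟧ where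
  toFun f := PowerSeries.mk fun n => ξ (coeffFun n f)
  map_add' f g := by
    ext n
    simp [coeffFun_add]
  map_smul' r f := by
    ext n
    simp [coeffFun_smul]

theorem coeff_series {χ : CurveJets W R} (ξ : TangentVector (CurveJets W R) χ) (n : ℕ)
    (f : SmoothFun W) : coeff n (series ξ f) = ξ (coeffFun n f) := by
  change coeff n (PowerSeries.mk fun n => ξ (coeffFun n f)) = _
  rw [coeff_mk]

theorem isTwisted_series {χ : CurveJets W R} (ξ : TangentVector (CurveJets W R) χ) :
    IsTwisted (hom χ) (hom χ) (series ξ) := by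
  intro f g
  ext n
  rw [coeff_series, coeffFun_mul, map_sum, map_add, mul_comm (hom χ g), coeff_mul, coeff_mul,
    ← Finset.sum_add_distrib]
  refine Finset.sum_congr rfl fun p _ => ?_
  rw [ξ.leibniz, coeff_series, coeff_series]
  change coeff p.1 (hom χ f) * _ + coeff p.2 (hom χ g) * _ = _
  ring

theorem series_rel {χ : CurveJets W R} (ξ : TangentVector (CurveJets W R) χ) {p} (hp : p ∈ R) :
    d⁄dX ℝ (series ξ p.1) = series ξ p.2 := by
  ext n
  rw [coeff_derivative, coeff_series, coeff_series, coeffFun_rel n hp, map_smul, smul_eq_mul,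
    mul_comm]

/-- All derivations over `χ` which are compatible with the relations come from tangent vectors. -/
def HasTangents (χ : CurveJets W R) : Prop :=
  ∀ η : SmoothFun W →ₗ[ℝ] ℝ⟦X⟧, IsTwisted (hom χ) (hom χ) η →
    (∀ p ∈ R, d⁄dX ℝ (η p.1) = η p.2) →
    ∃ ξ : TangentVector (CurveJets W R) χ, ∀ n f, ξ (coeffFun n f) = coeff n (η f)

/-- Both `series ξ` and `η` are derivations over `hom χ`, hence so is their difference, and
comparison on local generators suffices. A tangent vector may therefore be constructed in
coordinates and afterwards recognized on all Taylor coefficients. -/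
theorem eq_of_generators_tangent {χ : CurveJets W R} {η : SmoothFun W →ₗ[ℝ] ℝ⟦X⟧}
    (hη : IsTwisted (hom χ) (hom χ) η) {G : Set (SmoothFun W)} (hG : GeneratesAt G (pt χ))
    (ξ : TangentVector (CurveJets W R) χ)
    (hn : ∀ n, (∀ f, (PowerSeries.X : ℝ⟦X⟧) ^ n ∣ series ξ f - η f) →
      ∀ g ∈ G, ξ (coeffFun n g) = coeff n (η g)) (n : ℕ) (f : SmoothFun W) :
    ξ (coeffFun n f) = coeff n (η f) := by
  rw [← coeff_series]
  have : series ξ - η = 0 := by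
    refine IsTwisted.eq_zero (centred χ) (centred χ) (fun f g => ?_) hG fun n hn' g hg => ?_
    · simp only [LinearMap.sub_apply, isTwisted_series ξ f g, hη f g]
      ring
    · rw [LinearMap.sub_apply, map_sub, coeff_series, hn n hn' g hg, sub_self]
  rw [sub_eq_zero.1 this]

/-- A derivation over the image jet depends on germs at the point only. It descends to functions on
`Q`, is realized there by a tangent vector, and this vector is pushed forward. -/
theorem HasTangents.map {Q : DiffSpace.{u}} {R' : Set (SmoothFun Q × SmoothFun Q)} {i : SMap Q W}
    (hi : IsOpenEmb i) (h : ∀ p ∈ R, (i.pull p.1, i.pull p.2) ∈ R')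
    (h' : ∀ p' ∈ R', ∃ p ∈ R, (i.pull p.1, i.pull p.2) = p') {χ : CurveJets Q R'}
    (hχ : HasTangents χ) : HasTangents (map i h χ) := by
  intro η hη hR
  obtain ⟨η', hη'⟩ := hi.exists_lift (pt χ) η fun f g e =>
    hη.congr (centred (CurveJets.map i h χ)) (centred (CurveJets.map i h χ)) e
  have key : ∀ f, η' (i.pull f) = η f := fun f => hη' _ _ EventuallyEq.rfl
  obtain ⟨ξ, hξ⟩ := hχ η' (fun f g => by
    obtain ⟨f', hf⟩ := hi.extend f (pt χ)
    obtain ⟨g', hg⟩ := hi.extend g (pt χ)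
    rw [hη' f f' hf, hη' g g' hg, hη' (f * g) (f' * g') (by rw [map_mul]; exact hf.mul hg), hη,
      (centred χ).congr hf, (centred χ).congr hg]
    rfl) (fun p' hp' => by
    obtain ⟨p, hp, rfl⟩ := h' p' hp'
    rw [key, key, hR p hp])
  refine ⟨pushforward _ ξ, fun n f => ?_⟩
  exact (hξ n (i.pull f)).trans (by rw [key])

end Tangent

/-! ### Jets of curves in open subsets of coordinate spaces -/

section Open

variable {ι : Type}

/-- The jets of curves in `V`, in coordinates. -/
def jetSet (V : Set (coordSpace ι)) : Set (coordSpace (ι × ℕ)) := {v | (fun i => v (i, 0)) ∈ V}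

/-- The projection of jets of curves in coordinates. -/
def coordProj (ι : Type) : SMap (coordSpace (ι × ℕ)) (coordSpace ι) := intoCoord fun i => coordS (i, 0)

theorem isOpen_jetSet {V : Set (coordSpace ι)} (hV : IsOpen V) : IsOpen (jetSet V) :=
  hV.preimage (coordProj ι).continuous

/-- The coordinates on an open subset. -/
def subCoord (V : Set (coordSpace ι)) (i : ι) : SmoothFun ((coordSpace ι).sub V) :=
  (inclusion _ V).pull (coordS i)

theorem generatesAt_subCoord (V : Set (coordSpace ι)) (x : (coordSpace ι).sub V) :
    GeneratesAt (range (subCoord V)) x := by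
  have := generatesAt_sub x (generatesAt_coord x.1)
  rwa [← range_comp] at this

/-- The shift vector field in coordinates. -/
theorem exists_shift {V : Set (coordSpace ι)} (hV : IsOpen V) :
    ∃ S : VectorField ((coordSpace (ι × ℕ)).sub (jetSet V)), ∀ i n,
      S (subCoord (jetSet V) (i, n)) = ((n : ℝ) + 1) • subCoord (jetSet V) (i, n + 1) := by
  have h : ∀ v : (coordSpace (ι × ℕ)).sub (jetSet V), ∃ ξ : TangentVector _ v, ∀ i n,
      ξ (subCoord (jetSet V) (i, n)) = ((n : ℝ) + 1) * v.1 (i, n + 1) := by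
    intro v
    -- Under translation in `t` the Taylor coefficient of order `n` changes with speed `n + 1` times
    -- that of order `n + 1`.
    obtain ⟨ξ, hξ⟩ := exists_tangent_coord v.1 fun p => ((p.2 : ℝ) + 1) * v.1 (p.1, p.2 + 1)
    obtain ⟨ζ, hζ⟩ := (IsOpenEmb.inclusion (isOpen_jetSet hV)).exists_lift_tangent (q := v) rfl ξ
    exact ⟨ζ, fun i n => (hζ _).trans (hξ _)⟩
  choose ξ hξ using h
  obtain ⟨S, hS⟩ := exists_vectorField (generatesAt_subCoord (jetSet V)) ξ (by
    rintro _ ⟨⟨i, n⟩, rfl⟩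
    simp only [hξ]
    exact (((n : ℝ) + 1) • subCoord (jetSet V) (i, n + 1)).2)
  exact ⟨S, fun i n => Subtype.ext (funext fun v => (hS _ _).trans (hξ _ _ _))⟩

/-- Without relations the Taylor coefficients of the coordinates are arbitrary, apart from the base
point lying in `V`, and they determine the jet. The inverse is the formal flow of the shift field,
which yields the expansion of all smooth functions at once, without composing them with a power
series by hand. -/
theorem exists_diffeo_jetSet {V : Set (coordSpace ι)} (hV : IsOpen V) :
    ∃ e : Diffeo (CurveJets ((coordSpace ι).sub V) ∅) ((coordSpace (ι × ℕ)).sub (jetSet V)),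
      ∀ χ i n, (e.toSMap χ).1 (i, n) = coeff n (hom χ (subCoord V i)) := by
  obtain ⟨S, hS⟩ := exists_shift hV
  let c : SMap (CurveJets ((coordSpace ι).sub V) ∅) ((coordSpace (ι × ℕ)).sub (jetSet V)) :=
    intoSub (intoCoord fun p => coeffFun p.2 (subCoord V p.1)) (fun χ => by
      have : (fun i => coeff 0 (hom χ (subCoord V i))) = (pt χ).1 := funext fun i => by
        rw [coeff_zero_eq_constantCoeff_apply, centred χ]
        rfl
      change (fun i => coeff 0 (hom χ (subCoord V i))) ∈ V
      rw [this]
      exact (pt χ).2)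
  have hc : ∀ χ i n, (c χ).1 (i, n) = coeff n (hom χ (subCoord V i)) := fun _ _ _ => rfl
  let p : SMap ((coordSpace (ι × ℕ)).sub (jetSet V)) ((coordSpace ι).sub V) :=
    intoSub ((coordProj ι).comp (inclusion _ _)) fun v => v.2
  let d : SMap ((coordSpace (ι × ℕ)).sub (jetSet V)) (CurveJets ((coordSpace ι).sub V) ∅) :=
    flow S p fun _ h => h.elim
  have hcd : ∀ v, c (d v) = v := by
    intro v
    refine Subtype.ext (funext fun ⟨i, n⟩ => ?_)
    rw [hc, hom_flow]
    change coeff n (expSeries S v (subCoord (jetSet V) (i, 0))) = _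
    rw [expSeries, coeff_mk]
    -- The factors `1, 2, …, n` of the shift accumulate to `n!`, which the exponential series
    -- cancels.
    have : S^[n] (subCoord (jetSet V) (i, 0)) = (n.factorial : ℝ) • subCoord (jetSet V) (i, n) := by
      induction n with
      | zero => simp
      | succ n ih =>
        rw [Function.iterate_succ_apply', ih, S.map_smul, hS, smul_smul, Nat.factorial_succ]
        push_cast
        rw [mul_comm]
    rw [this]
    change (n.factorial : ℝ)⁻¹ * ((n.factorial : ℝ) * v.1 (i, n)) = _
    field_simp
  have hinj : Function.Injective c.toFun := by
    intro χ χ' h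
    have h1 : ∀ i n, coeff n (hom χ (subCoord V i)) = coeff n (hom χ' (subCoord V i)) :=
      fun i n => congrArg (fun v : (coordSpace (ι × ℕ)).sub (jetSet V) => v.1 (i, n)) h
    refine eq_of_generators ?_ (generatesAt_subCoord V _) ?_
    · refine Subtype.ext (funext fun i => ?_)
      have := h1 i 0
      rw [coeff_zero_eq_constantCoeff_apply, coeff_zero_eq_constantCoeff_apply, centred χ,
        centred χ'] at this
      exact this
    · rintro n - _ ⟨i, rfl⟩
      exact h1 i n
  exact ⟨⟨c, d, fun χ => hinj (hcd _), hcd⟩, hc⟩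

/-- The coordinates on this space of jets are independent, so a tangent vector can be given the
components of `η` on them. -/
theorem hasTangents_open {V : Set (coordSpace ι)} (hV : IsOpen V)
    (χ : CurveJets ((coordSpace ι).sub V) ∅) : HasTangents χ := by
  obtain ⟨e, he⟩ := exists_diffeo_jetSet hV
  intro η hη _
  obtain ⟨ξ, hξ⟩ := exists_tangent_coord (e.toSMap χ).1 fun p => coeff p.2 (η (subCoord V p.1))
  obtain ⟨ζ, hζ⟩ := ((IsOpenEmb.inclusion (isOpen_jetSet hV)).comp
    (IsOpenEmb.diffeo e)).exists_lift_tangent (q := χ) rfl ξ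
  refine ⟨ζ, eq_of_generators_tangent hη (generatesAt_subCoord V _) ζ ?_⟩
  rintro n - _ ⟨i, rfl⟩
  rw [← hξ (i, n), ← hζ]
  congr 1
  exact Subtype.ext (funext fun χ' => (he χ' i n).symm)

end Open

end CurveJets

/-! ### Tangent vectors of products -/

section

variable {A : DiffSpace.{u}} {B : DiffSpace.{v}}

/-- Tangent vectors of a product with given components. -/
theorem exists_tangent_prod (p : A.prod B) (ξ : TangentVector A p.1) (ζ : TangentVector B p.2) :
    ∃ θ : TangentVector (A.prod B) p,
      (∀ f, θ ((fstS A B).pull f) = ξ f) ∧ ∀ g, θ ((sndS A B).pull g) = ζ g := by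
  let θ₁ : TangentVector (A.prod B) p := pushforward (pairS (idS A) (constS A p.2)) ξ
  let θ₂ : TangentVector (A.prod B) p := pushforward (pairS (constS B p.1) (idS B)) ζ
  refine ⟨θ₁ + θ₂, fun f => ?_, fun g => ?_⟩
  · rw [TangentVector.add_apply]
    have h : θ₂ ((fstS A B).pull f) = 0 := ζ.map_algebraMap (f p.1)
    rw [h, add_zero]
    rfl
  · rw [TangentVector.add_apply]
    have h : θ₁ ((sndS A B).pull g) = 0 := ξ.map_algebraMap (g p.2)
    rw [h, zero_add]
    rfl

end

namespace CurveJets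

/-! ### Vector fields on spaces of jets -/

section Fields

variable {W : DiffSpace.{w}} {R : Set (SmoothFun W × SmoothFun W)}

/-- `HasTangents` realizes each `η χ` by a tangent vector; the functions `c n f` show that these
vary smoothly with `χ`, which need only be known on the generators. -/
theorem exists_field (h : ∀ χ : CurveJets W R, HasTangents χ)
    (η : CurveJets W R → SmoothFun W →ₗ[ℝ] ℝ⟦X⟧) (hη : ∀ χ, IsTwisted (hom χ) (hom χ) (η χ))
    (hR : ∀ χ, ∀ p ∈ R, d⁄dX ℝ (η χ p.1) = η χ p.2)
    (c : ℕ → SmoothFun W → SmoothFun (CurveJets W R)) (hc : ∀ n f χ, c n f χ = coeff n (η χ f)) :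
    ∃ D : VectorField (CurveJets W R), ∀ n f, D (coeffFun n f) = c n f := by
  choose ξ hξ using fun χ => h χ (η χ) (hη χ) (hR χ)
  obtain ⟨D, hD⟩ := exists_vectorField generatesAt ξ (by
    rintro _ ⟨n, f, rfl⟩
    simp only [hξ, ← hc]
    exact (c n f).2)
  exact ⟨D, fun n f => Subtype.ext (funext fun χ => by rw [hD, hξ, hc])⟩

theorem field_ext {D D' : VectorField (CurveJets W R)}
    (h : ∀ n f, D (coeffFun n f) = D' (coeffFun n f)) : D = D' :=
  vectorField_ext generatesAt (by
    rintro _ ⟨n, f, rfl⟩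
    exact h n f)

/-- The vector field which moves the base point along the curve. -/
theorem exists_velocity (h : ∀ χ : CurveJets W R, HasTangents χ) :
    ∃ D : VectorField (CurveJets W R), ∀ n f,
      D (coeffFun n f) = ((n : ℝ) + 1) • coeffFun (n + 1) f :=
  exists_field h (fun χ => (d⁄dX ℝ).toLinearMap ∘ₗ (hom χ).toLinearMap)
    (fun χ f g => by
      change d⁄dX ℝ (hom χ (f * g)) = hom χ f * d⁄dX ℝ (hom χ g) + hom χ g * d⁄dX ℝ (hom χ f)
      rw [map_mul, Derivation.leibniz, smul_eq_mul, smul_eq_mul])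
    (fun χ p hp => congrArg (d⁄dX ℝ) (rel χ p hp)) (fun n f => ((n : ℝ) + 1) • coeffFun (n + 1) f)
    (fun n f χ => by
      change ((n : ℝ) + 1) * coeff (n + 1) (hom χ f) = coeff n (d⁄dX ℝ (hom χ f))
      rw [coeff_derivative, mul_comm])

/-- The recursion step for a formal differential equation: agreement of the right-hand sides through
order `n` gives agreement of the solutions at order `n + 1`. -/
theorem coeff_succ_eq {a b a' b' : ℝ⟦X⟧} (ha : d⁄dX ℝ a = a') (hb : d⁄dX ℝ b = b') {n : ℕ}
    (h : (PowerSeries.X : ℝ⟦X⟧) ^ (n + 1) ∣ a' - b') : coeff (n + 1) a = coeff (n + 1) b := by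
  rw [← sub_eq_zero, ← map_sub]
  apply coeff_succ_eq_zero
  rw [map_sub, ha, hb]
  exact X_pow_dvd_iff.1 h n (Nat.lt_succ_self n)

end Fields

/-! ### Jets of curves in a product whose first component is prescribed -/

section Prod

variable {A : DiffSpace.{v}} {F : DiffSpace.{w}} {T : Type*} (α : T → SmoothFun A)
  (b : T → SmoothFun (A.prod F))

/-- The relations which prescribe the derivatives of the functions `α` on the first factor. -/
def prodRel : Set (SmoothFun (A.prod F) × SmoothFun (A.prod F)) :=
  range fun t => ((fstS A F).pull (α t), b t)

/-- The components of a jet of curves in the product. -/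
def prodComponents : SMap (CurveJets (A.prod F) (prodRel α b)) (A.prod (CurveJets F ∅)) :=
  pairS ((fstS A F).comp (proj _ _)) (map (sndS A F) fun _ h => h.elim)

theorem generatesAt_prodGens (hα : ∀ x, GeneratesAt (range α) x) (y : A.prod F) :
    GeneratesAt ((fstS A F).pull '' range α ∪ (sndS A F).pull '' univ) y :=
  generatesAt_prod y (hα _) fun f => isLocFun_of_eventuallyEq (mem_univ f) EventuallyEq.rfl

/-- Uniqueness for the differential equation of the first component. The initial point and the jet
in `F` are known, and the coefficient of order `n + 1` of `α t` follows from that of order `n` of `b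
t`, where the two jets already agree. -/
theorem prodComponents_injective (hα : ∀ x, GeneratesAt (range α) x) :
    Function.Injective (prodComponents α b).toFun := by
  intro χ χ' h
  have h1 : (pt χ).1 = (pt χ').1 := congrArg (Prod.fst : A × CurveJets F ∅ → A) h
  have h2 : map (R := ∅) (sndS A F) (fun _ h => h.elim) χ = map (sndS A F) (fun _ h => h.elim) χ' :=
    congrArg (Prod.snd : A × CurveJets F ∅ → CurveJets F ∅) h
  have h3 : (pt χ).2 = (pt χ').2 := congrArg pt h2
  have h4 : pt χ = pt χ' := Prod.ext h1 h3
  refine eq_of_generators h4 (generatesAt_prodGens α hα _) ?_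
  rintro n hn _ (⟨_, ⟨t, rfl⟩, rfl⟩ | ⟨f, -, rfl⟩)
  · cases n with
    | zero =>
      rw [coeff_zero_eq_constantCoeff_apply, coeff_zero_eq_constantCoeff_apply, centred χ,
        centred χ', h4]
    | succ n => exact coeff_succ_eq (rel χ _ ⟨t, rfl⟩) (rel χ' _ ⟨t, rfl⟩) (hn _)
  · exact congrArg (fun χ => coeff n (hom χ f)) h2

variable (σ : ∀ y : A.prod F, TangentVector A y.1) (hσ : ∀ y t, σ y (α t) = b t y)
  (hα : ∀ x, GeneratesAt (range α) x) (hF : ∀ χ : CurveJets F ∅, HasTangents χ)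

include hσ hα hF

/-- Existence for the same equation. On pairs (point of `A`, jet in `F`) take the field that moves
the point with velocity `σ` and the jet by translation in time. Its formal trajectories, projected
to `A × F`, satisfy the relations and have the given jet as second component. -/
theorem exists_prod_inverse : ∃ d : SMap (A.prod (CurveJets F ∅)) (CurveJets (A.prod F) (prodRel α b)),
    ∀ z, prodComponents α b (d z) = z := by
  obtain ⟨D, hD⟩ := exists_velocity hF
  let p : SMap (A.prod (CurveJets F ∅)) (A.prod F) :=
    pairS (fstS _ _) ((proj F ∅).comp (sndS _ _))
  choose ξ hξ₁ hξ₂ using fun z : A.prod (CurveJets F ∅) =>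
    exists_tangent_prod z (σ (p z)) (valueAt D z.2)
  obtain ⟨S, hS⟩ := exists_vectorField
    (fun z => generatesAt_prod z (hα z.1) (generatesAt z.2)) ξ (by
    rintro _ (⟨_, ⟨t, rfl⟩, rfl⟩ | ⟨f, -, rfl⟩)
    · simp only [hξ₁, hσ]
      exact (p.pull (b t)).2
    · simp only [hξ₂]
      exact ((sndS A (CurveJets F ∅)).pull (D f)).2)
  have hS₁ : ∀ t, S ((fstS _ _).pull (α t)) = p.pull (b t) := fun t =>
    Subtype.ext (funext fun z => (hS _ z).trans ((hξ₁ z _).trans (hσ _ t)))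
  have hS₂ : ∀ f, S ((sndS _ _).pull f) = (sndS A (CurveJets F ∅)).pull (D f) := fun f =>
    Subtype.ext (funext fun z => (hS _ z).trans (hξ₂ z _))
  refine ⟨flow S p (by rintro _ ⟨t, rfl⟩; exact hS₁ t), fun z => ?_⟩
  refine Prod.ext rfl (ext' rfl (AlgHom.ext fun f => ?_))
  ext n
  change coeff n (expSeries S z (p.pull ((sndS A F).pull f))) = coeff n (hom z.2 f)
  have h0 : p.pull ((sndS A F).pull f) = (sndS A (CurveJets F ∅)).pull (coeffFun 0 f) := by
    rw [← proj_pull]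
    rfl
  -- On the second factor `S` is the translation field, so its exponential reproduces the Taylor
  -- coefficients of the given jet.
  have h : S^[n] ((sndS A (CurveJets F ∅)).pull (coeffFun 0 f)) =
      (n.factorial : ℝ) • (sndS A (CurveJets F ∅)).pull (coeffFun n f) := by
    induction n with
    | zero => simp
    | succ n ih =>
      rw [Function.iterate_succ_apply', ih, S.map_smul, hS₂, hD, map_smul, smul_smul,
        Nat.factorial_succ]
      push_cast
      rw [mul_comm]
  rw [expSeries, coeff_mk, h0, h]
  change (n.factorial : ℝ)⁻¹ * ((n.factorial : ℝ) * coeff n (hom z.2 f)) = _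
  have : (n.factorial : ℝ) ≠ 0 := by positivity
  field_simp

theorem exists_diffeo_prod :
    ∃ e : Diffeo (CurveJets (A.prod F) (prodRel α b)) (A.prod (CurveJets F ∅)),
      e.toSMap = prodComponents α b := by
  obtain ⟨d, hd⟩ := exists_prod_inverse α b σ hσ hα hF
  exact ⟨⟨prodComponents α b, d, fun χ => prodComponents_injective α b hα (hd _), hd⟩, rfl⟩

/-- The linearized equation: `η` is determined by its constant terms on functions from `A` and by
its values on functions from `F`. A tangent vector with these two components exists on `A × (jets in
F)`; it agrees with `η` by the same recursion on coefficients as in `prodComponents_injective`. -/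
theorem hasTangents_prod (χ : CurveJets (A.prod F) (prodRel α b)) : HasTangents χ := by
  obtain ⟨e, he⟩ := exists_diffeo_prod α b σ hσ hα hF
  intro η hη hR
  let χ' : CurveJets F ∅ := map (sndS A F) (fun _ h => h.elim) χ
  obtain ⟨ξ, hξ⟩ := hF χ' (η ∘ₗ (sndS A F).pull.toLinearMap) (fun f g => by
    change η ((sndS A F).pull (f * g)) = _
    rw [map_mul, hη]
    rfl) (fun _ h => h.elim)
  -- Constant terms turn the derivation over `hom χ` into a derivation at the base point, the
  -- initial value of the linearized equation.
  let ζ : TangentVector A (pt χ).1 := ⟨(coeff 0) ∘ₗ η ∘ₗ (fstS A F).pull.toLinearMap, fun f g => by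
    change coeff 0 (η ((fstS A F).pull (f * g))) = f (pt χ).1 * coeff 0 (η ((fstS A F).pull g)) +
      g (pt χ).1 * coeff 0 (η ((fstS A F).pull f))
    simp only [coeff_zero_eq_constantCoeff_apply]
    rw [map_mul, hη, map_add, map_mul, map_mul, centred χ,
      centred χ]
    rfl⟩
  obtain ⟨θ, hθ₁, hθ₂⟩ := exists_tangent_prod (prodComponents α b χ) ζ ξ
  obtain ⟨ν, hν⟩ := (IsOpenEmb.diffeo e).exists_lift_tangent (q := χ)
    (w := prodComponents α b χ) (by rw [he]) θ
  rw [he] at hν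
  refine ⟨ν, eq_of_generators_tangent hη (generatesAt_prodGens α hα _) ν ?_⟩
  rintro n hn _ (⟨_, ⟨t, rfl⟩, rfl⟩ | ⟨f, -, rfl⟩)
  · cases n with
    | zero =>
      rw [← proj_pull]
      exact (hν ((fstS _ _).pull (α t))).trans (hθ₁ _)
    | succ n =>
      rw [← coeff_series]
      exact coeff_succ_eq (series_rel ν (p := ((fstS A F).pull (α t), b t)) ⟨t, rfl⟩)
        (hR _ ⟨t, rfl⟩) (hn _)
  · exact (hν ((sndS _ _).pull (coeffFun n f))).trans ((hθ₂ _).trans (hξ n f))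

end Prod

end CurveJets

/-! ### Manifolds -/

section Manifolds

variable {X : DiffSpace.{u}} {Y : DiffSpace.{v}} {Q : DiffSpace.{w}}

/-- Composition of diffeomorphisms. -/
def Diffeo.trans (e : Diffeo X Y) (e' : Diffeo Y Q) : Diffeo X Q :=
  ⟨e'.toSMap.comp e.toSMap, e.invSMap.comp e'.invSMap,
    fun x => (congrArg e.invSMap.toFun (e'.left_inv _)).trans (e.left_inv x),
    fun x => (congrArg e'.toSMap.toFun (e.right_inv _)).trans (e'.right_inv x)⟩

theorem HasChartAt.exists_isOpenEmb {ι : Type} {x : X} (h : HasChartAt ι X x) :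
    ∃ V : Set (coordSpace ι), IsOpen V ∧ ∃ i : SMap ((coordSpace ι).sub V) X,
      IsOpenEmb i ∧ x ∈ range i.toFun := by
  obtain ⟨U, hU, hx, V, hV, ⟨e⟩⟩ := h
  refine ⟨V, hV, (inclusion X U).comp e.symm.toSMap,
    (IsOpenEmb.inclusion hU).comp (IsOpenEmb.diffeo e.symm), e.toSMap ⟨x, hx⟩, ?_⟩
  exact congrArg (Subtype.val : U → X) (e.left_inv ⟨x, hx⟩)

theorem IsOpenEmb.hasChartAt {ι : Type} {V : Set (coordSpace ι)} (hV : IsOpen V)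
    {i : SMap ((coordSpace ι).sub V) X} (hi : IsOpenEmb i) {x : X} (hx : x ∈ range i.toFun) :
    HasChartAt ι X x := by
  obtain ⟨e, -⟩ := hi.exists_diffeo
  exact ⟨_, hi.isOpenMap.isOpen_range, hx, V, hV, ⟨e⟩⟩

theorem IsOpenEmb.isOpenEmbedding {i : SMap X Y} (hi : IsOpenEmb i) :
    Topology.IsOpenEmbedding i.toFun :=
  .of_continuous_injective_isOpenMap i.continuous hi.injective hi.isOpenMap

theorem t2Space_of_separating (h : ∀ x y : X, x ≠ y → ∃ f : SmoothFun X, f x ≠ f y) : T2Space X :=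
  ⟨fun x y hxy => by
    obtain ⟨f, hf⟩ := h x y hxy
    exact separated_by_continuous (smoothFun_continuous f) hf⟩

theorem exists_separating [T2Space X] {x y : X} (h : x ≠ y) : ∃ f : SmoothFun X, f x ≠ f y := by
  obtain ⟨b, h1, h0⟩ := exists_smooth_bump (isOpen_compl_singleton.mem_nhds h)
  exact ⟨b, by rw [h1, h0 y (by simp)]; exact one_ne_zero⟩

theorem secondCountable_generate {A : Type u} {S : Set (A → ℝ)} (hS : S.Countable) :
    SecondCountableTopology (generate A S) := by
  have := hS.to_subtype
  change @SecondCountableTopology A (initialTop (genSet S))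
  rw [initialTop_genSet]
  exact TopologicalSpace.secondCountableTopology_induced _ _ _

theorem secondCountable_coord (ι : Type) [Countable ι] : SecondCountableTopology (coordSpace ι) := by
  apply secondCountable_generate
  rw [show {g : (ι → ℝ) → ℝ | ∃ i, g = fun v => v i} = range fun i v => v i by
    ext; simp [eq_comm]]
  exact countable_range _

theorem secondCountable_sub {ι : Type} [Countable ι] {V : Set (coordSpace ι)} (hV : IsOpen V) :
    SecondCountableTopology ((coordSpace ι).sub V) := by
  have := secondCountable_coord ι
  exact (IsOpenEmb.inclusion hV).isOpenEmbedding.isEmbedding.secondCountableTopology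

/-- The space `ℝ^κ` in an arbitrary universe. -/
def coordU (κ : Type) : DiffSpace.{u} :=
  generate (ULift.{u} (κ → ℝ)) {g | ∃ i, g = fun v => v.down i}

/-- The coordinates on `ℝ^κ`. -/
def coordUFun {κ : Type} (i : κ) : SmoothFun (coordU.{u} κ) :=
  ⟨fun v => ULift.down v i, subset_genSet _ ⟨i, rfl⟩⟩

/-- The map to `ℝ^κ` with given coordinates. -/
def intoCoordU {κ : Type} (t : κ → SmoothFun X) : SMap X (coordU.{v} κ) :=
  SMap.intoGenerate (fun z => ULift.up fun i => t i z) (by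
    rintro g ⟨i, rfl⟩
    exact (t i).2)

theorem isSmoothManifold_coordU (κ : Type) [Countable κ] : IsSmoothManifold (coordU.{u} κ) where
  hausdorff := t2Space_of_separating fun x y h => by
    by_contra! hf
    exact h (ULift.ext _ _ (funext fun i => hf (coordUFun i)))
  secondCountable := by
    apply secondCountable_generate
    rw [show {g : ULift.{u} (κ → ℝ) → ℝ | ∃ i, g = fun v => v.down i} = range fun i v => v.down i by
      ext; simp [eq_comm]]
    exact countable_range _
  charts := by
    refine ⟨κ, inferInstance, fun x => ?_⟩
    let e : Diffeo (coordSpace κ) (coordU.{u} κ) :=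
      ⟨intoCoordU coordS, intoCoord coordUFun, fun _ => rfl, fun _ => rfl⟩
    refine IsOpenEmb.hasChartAt isOpen_univ
      ((IsOpenEmb.diffeo e).comp (IsOpenEmb.inclusion isOpen_univ)) (x := x)
      ⟨⟨e.invSMap x, mem_univ _⟩, rfl⟩

/-- The product of a space and a diffeomorphism. -/
def Diffeo.prodLeft (e : Diffeo X Y) (Z : DiffSpace.{w}) : Diffeo (X.prod Z) (Y.prod Z) :=
  ⟨pairS (e.toSMap.comp (fstS X Z)) (sndS X Z), pairS (e.invSMap.comp (fstS Y Z)) (sndS Y Z),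
    fun p => Prod.ext (e.left_inv p.1) rfl, fun p => Prod.ext (e.right_inv p.1) rfl⟩

/-- Local trivializations from open embeddings of a product. -/
theorem exists_trivialization {B : DiffSpace.{u}} {W : DiffSpace.{v}} {B' : DiffSpace.{u'}}
    {W' Fib : DiffSpace.{w}}
    {τ : SMap W' W} {k : SMap B W} (hk : IsOpenEmb k) {K : SMap B' W'} (hK : IsOpenEmb K)
    (hr : range K.toFun = τ.toFun ⁻¹' range k.toFun) (e : Diffeo B' (B.prod Fib))
    (he : ∀ y, k (e.toSMap y).1 = τ (K y)) :
    ∃ e' : Diffeo (W'.sub (τ ⁻¹' range k.toFun)) ((W.sub (range k.toFun)).prod Fib),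
      ∀ y, (e'.toSMap y).1.1 = τ y.1 := by
  obtain ⟨e₁, h₁⟩ := hk.exists_diffeo
  obtain ⟨e₂, h₂⟩ := hK.exists_diffeo
  rw [← hr]
  refine ⟨(e₂.trans e).trans (e₁.symm.prodLeft Fib), fun y => ?_⟩
  have h3 := h₁ (e₁.symm.toSMap (e.toSMap (e₂.toSMap y)).1)
  refine h3.symm.trans ((congrArg k.toFun (e₁.right_inv _)).trans ?_)
  rw [he, h₂]

end Manifolds

/-! ### Jets of curves in a manifold form a manifold -/

namespace CurveJets

section

theorem coordSpace_isOpenEmb {ι : Type} {V : Set (coordSpace ι)} (hV : IsOpen V) :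
    ∃ i : SMap ((coordSpace (ι × ℕ)).sub (jetSet V)) (CurveJets ((coordSpace ι).sub V) ∅),
      IsOpenEmb i ∧ Function.Surjective i.toFun := by
  obtain ⟨e, -⟩ := exists_diffeo_jetSet hV
  exact ⟨e.symm.toSMap, IsOpenEmb.diffeo e.symm, fun x => ⟨e.toSMap x, e.left_inv x⟩⟩

variable {F : DiffSpace.{w}}

/-- A chart of `F` with domain `V` induces a chart on the jets of curves centred in it. The set `V`
and the embedding are packed together so that a single choice over all points `y` is possible
although the embedding depends on `V`. -/
theorem exists_chart {ι : Type} {y : F} (h : HasChartAt ι F y) :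
    ∃ i : Σ V : Set (coordSpace ι), SMap ((coordSpace (ι × ℕ)).sub (jetSet V)) (CurveJets F ∅),
      IsOpen (jetSet i.1) ∧ IsOpenEmb i.2 ∧
      ∃ U ∈ 𝓝 y, range i.2.toFun = {χ | pt χ ∈ U} ∧ ∀ χ ∈ range i.2.toFun, HasTangents χ := by
  obtain ⟨V, hV, i, hi, hy⟩ := h.exists_isOpenEmb
  obtain ⟨j, hj, hjs⟩ := coordSpace_isOpenEmb hV
  have h1 := isOpenEmb_map (R := ∅) (R' := ∅) hi (fun _ h => h.elim) (fun _ h => h.elim)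
  refine ⟨⟨V, (map (R := ∅) (R' := ∅) i fun _ h => h.elim).comp j⟩, isOpen_jetSet hV,
    h1.comp hj, range i.toFun, hi.isOpenMap.isOpen_range.mem_nhds hy, ?_, ?_⟩
  · rw [← range_map (R := ∅) (R' := ∅) hi (fun _ h => h.elim) (fun _ h => h.elim)]
    exact hjs.range_comp (map (R := ∅) (R' := ∅) i fun _ h => h.elim).toFun
  · rintro _ ⟨v, rfl⟩
    exact (hasTangents_open hV _).map (R := ∅) hi (fun _ h => h.elim) fun _ h => h.elim

theorem hasTangents_manifold (hF : IsSmoothManifold F) (χ : CurveJets F ∅) : HasTangents χ := by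
  obtain ⟨ι, -, hc⟩ := hF.charts
  obtain ⟨i, -, -, U, hU, hr, h⟩ := exists_chart (hc (pt χ))
  exact h χ (hr.ge (mem_of_mem_nhds (x := pt χ) hU))

/-- Taylor coefficients together with the base point separate jets. Countably many chart domains
cover `F`, and the jets over each are an open copy of a second countable open subset of `ℝ^(ι × ℕ)`.
-/
theorem isSmoothManifold (hF : IsSmoothManifold F) : IsSmoothManifold (CurveJets F ∅) where
  hausdorff := by
    have := hF.hausdorff
    refine t2Space_of_separating fun χ χ' h => ?_
    by_contra! hf
    refine h (ext' ?_ (AlgHom.ext fun f => ?_))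
    · by_contra hp
      obtain ⟨f, hne⟩ := exists_separating hp
      exact hne (hf ((proj F ∅).pull f))
    · ext n
      exact hf (coeffFun n f)
  secondCountable := by
    have := hF.secondCountable
    obtain ⟨ι, _, hc⟩ := hF.charts
    choose i hV hi U hU hr _ using fun y => exists_chart (hc y)
    obtain ⟨s, hs, hcov⟩ := TopologicalSpace.countable_cover_nhds hU
    have := hs.to_subtype
    have hsc : ∀ y : s, SecondCountableTopology (range (i y.1).2.toFun) := by
      intro y
      have := secondCountable_sub (hV y.1)
      exact (hi y.1).isOpenEmbedding.isEmbedding.toHomeomorph.symm.secondCountableTopology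
    refine TopologicalSpace.secondCountableTopology_of_countable_cover
      (U := fun y : s => range (i y.1).2.toFun) (fun y => (hi y.1).isOpenMap.isOpen_range) ?_
    rw [eq_univ_iff_forall] at hcov ⊢
    intro χ
    obtain ⟨y, hy, hχ⟩ := mem_iUnion₂.1 (hcov (pt χ))
    exact mem_iUnion.2 ⟨⟨y, hy⟩, (hr y).ge hχ⟩
  charts := by
    obtain ⟨ι, _, hc⟩ := hF.charts
    refine ⟨ι × ℕ, inferInstance, fun χ => ?_⟩
    obtain ⟨i, hV, hi, U, hU, hr, -⟩ := exists_chart (hc (pt χ))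
    exact IsOpenEmb.hasChartAt hV hi (hr.ge (mem_of_mem_nhds (x := pt χ) hU))

/-- Jets of curves in `V` form the product of `V` and a coordinate space. -/
theorem exists_diffeo_coordU {ι : Type} {V : Set (coordSpace ι)} (hV : IsOpen V) :
    ∃ e : Diffeo (CurveJets ((coordSpace ι).sub V) ∅)
      (((coordSpace ι).sub V).prod (coordU.{w} (ι × ℕ))), ∀ χ, (e.toSMap χ).1 = pt χ := by
  obtain ⟨e, he⟩ := exists_diffeo_jetSet hV
  let c : SMap (CurveJets ((coordSpace ι).sub V) ∅)
      (((coordSpace ι).sub V).prod (coordU.{w} (ι × ℕ))) :=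
    -- The order is shifted by one: the coefficients of order zero are the base point, so the fibre
    -- coordinates start at order one.
    pairS (proj _ _) (intoCoordU fun p => coeffFun (p.2 + 1) (subCoord V p.1))
  let d' : SMap (((coordSpace ι).sub V).prod (coordU.{w} (ι × ℕ)))
      ((coordSpace (ι × ℕ)).sub (jetSet V)) :=
    intoSub (intoCoord fun p => match p with
      | (i, 0) => (fstS _ _).pull (subCoord V i)
      | (i, n + 1) => (sndS _ _).pull (coordUFun (i, n))) fun z => (z.1 : (coordSpace ι).sub V).2
  refine ⟨⟨c, e.invSMap.comp d', fun χ => ?_, fun z => ?_⟩, fun _ => rfl⟩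
  · have : d' (c χ) = e.toSMap χ := by
      refine Subtype.ext (funext fun ⟨i, n⟩ => ?_)
      rw [he]
      cases n with
      | zero =>
        rw [coeff_zero_eq_constantCoeff_apply, centred χ]
        rfl
      | succ n => rfl
    exact (congrArg e.invSMap.toFun this).trans (e.left_inv χ)
  · have h : ∀ i n, coeff n (hom (e.invSMap (d' z)) (subCoord V i)) = (d' z).1 (i, n) := by
      intro i n
      rw [← he, e.right_inv]
    refine Prod.ext (Subtype.ext (funext fun i => ?_)) (ULift.ext _ _ (funext fun ⟨i, n⟩ => ?_))
    · have h1 := h i 0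
      rw [coeff_zero_eq_constantCoeff_apply, centred] at h1
      exact h1
    · exact h i (n + 1)

end

end CurveJets

open CurveJets

/-! ### Reconstruction of shadows -/

section Reconstruction

variable {M : DiffSpace.{u}} {X : DiffSpace.{v}} {W : DiffSpace.{w}} {π : SMap X M}

/-- The relations `d f(τ(γ(t)))/dt = s(γ(t))(f)` for jets of curves `γ` in `W`. -/
def shadowRel (τ : SMap W X) (s : SMap W (verticalTangent π)) : Set (SmoothFun W × SmoothFun W) :=
  range fun f : SmoothFun X => (τ.pull f, s.pull (dFun π f))

theorem VerticalVector.ext_of_apply {v v' : VerticalVector π} (h : v.pt = v'.pt)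
    (h' : ∀ f, v.vec f = v'.vec f) : v = v' := by
  obtain ⟨x, ξ, _⟩ := v
  obtain ⟨y, ζ, _⟩ := v'
  obtain rfl : x = y := h
  obtain rfl : ξ = ζ := TangentVector.ext h'
  rfl

/-! ### The space of jets over a local trivialization -/

section Local

variable {F : DiffSpace.{u'}} {τ : SMap W X} {s : SMap W (verticalTangent π)} {U : Set X}
  {j : SMap ((X.sub U).prod F) W}

variable (s j) in
/-- The relations in a local trivialization. -/
abbrev localRel : Set (SmoothFun ((X.sub U).prod F) × SmoothFun ((X.sub U).prod F)) :=
  prodRel (fun f : SmoothFun X => (inclusion X U).pull f) fun f => j.pull (s.pull (dFun π f))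

theorem pull_pull_eq (hτj : ∀ p, τ (j p) = p.1.1) (f : SmoothFun X) :
    j.pull (τ.pull f) = (fstS (X.sub U) F).pull ((inclusion X U).pull f) :=
  Subtype.ext (funext fun p => congrArg f.1 (hτj p))

theorem mem_localRel (hτj : ∀ p, τ (j p) = p.1.1) :
    ∀ p ∈ shadowRel τ s, (j.pull p.1, j.pull p.2) ∈ localRel s j := by
  rintro _ ⟨f, rfl⟩
  exact ⟨f, by rw [pull_pull_eq hτj]⟩

theorem localRel_lift (hτj : ∀ p, τ (j p) = p.1.1) :
    ∀ p' ∈ localRel s j, ∃ p ∈ shadowRel τ s, (j.pull p.1, j.pull p.2) = p' := by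
  rintro _ ⟨f, rfl⟩
  exact ⟨_, ⟨f, rfl⟩, by rw [pull_pull_eq hτj]⟩

theorem generatesAt_inclusion (x : X.sub U) :
    GeneratesAt (range fun f : SmoothFun X => (inclusion X U).pull f) x := fun g => by
  obtain ⟨f, hf⟩ := exists_extension g x
  exact isLocFun_of_eventuallyEq ⟨f, rfl⟩ hf

/-- The shadow lies over `τ`, so its value at `j p` is a tangent vector of `X` at the point `p.1` of
the open set `U` and restricts to `U`. Hence the right-hand sides of the relations are values of
genuine tangent vectors, as required to solve the equation. -/
theorem exists_localTangent (hs : (verticalProj π).comp s = τ) (hU : IsOpen U)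
    (hτj : ∀ p, τ (j p) = p.1.1) : ∃ σ : ∀ p : (X.sub U).prod F, TangentVector (X.sub U) p.1,
      ∀ p (f : SmoothFun X), σ p ((inclusion X U).pull f) = j.pull (s.pull (dFun π f)) p := by
  choose σ hσ using fun p : (X.sub U).prod F =>
    (IsOpenEmb.inclusion hU).exists_lift_tangent (q := p.1) (w := VerticalVector.pt (s (j p)))
      ((hτj p).symm.trans (congrArg (fun F : SMap W X => F (j p)) hs).symm)
      (VerticalVector.vec (s (j p)))
  exact ⟨σ, hσ⟩

theorem exists_diffeo_local (hs : (verticalProj π).comp s = τ) (hU : IsOpen U)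
    (hτj : ∀ p, τ (j p) = p.1.1) (hF : ∀ χ : CurveJets F ∅, HasTangents χ) :
    ∃ e : Diffeo (CurveJets ((X.sub U).prod F) (localRel s j)) ((X.sub U).prod (CurveJets F ∅)),
      ∀ χ, (e.toSMap χ).1 = (pt χ).1 ∧ pt (e.toSMap χ).2 = (pt χ).2 := by
  obtain ⟨σ, hσ⟩ := exists_localTangent hs hU hτj
  obtain ⟨e, he⟩ := exists_diffeo_prod _ _ σ hσ generatesAt_inclusion hF
  exact ⟨e, fun χ => by rw [he]; exact ⟨rfl, rfl⟩⟩

theorem hasTangents_local (hs : (verticalProj π).comp s = τ) (hU : IsOpen U) (hj : IsOpenEmb j)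
    (hτj : ∀ p, τ (j p) = p.1.1) (hF : ∀ χ : CurveJets F ∅, HasTangents χ)
    (χ : CurveJets W (shadowRel τ s)) (hχ : pt χ ∈ range j.toFun) : HasTangents χ := by
  obtain ⟨σ, hσ⟩ := exists_localTangent hs hU hτj
  obtain ⟨χ', rfl⟩ := (range_map hj (mem_localRel hτj) (localRel_lift hτj)).ge hχ
  exact (hasTangents_prod _ _ σ hσ generatesAt_inclusion hF χ').map hj _ (localRel_lift hτj)

end Local

/-! ### Local triviality over `W` and over `X` -/

variable {τ : SMap W X} {s : SMap W (verticalTangent π)}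

/-- A local trivialization as an open embedding of a product. -/
theorem exists_openEmb_of_trivialization {F : DiffSpace.{u'}} {U : Set X} (hU : IsOpen U)
    (e : Diffeo (W.sub (τ ⁻¹' U)) ((X.sub U).prod F)) (he : ∀ y, (e.toSMap y).1.1 = τ y.1) :
    ∃ j : SMap ((X.sub U).prod F) W, IsOpenEmb j ∧ (∀ p, τ (j p) = p.1.1) ∧
      range j.toFun = τ ⁻¹' U := by
  refine ⟨(inclusion W _).comp e.symm.toSMap,
    (IsOpenEmb.inclusion (hU.preimage τ.continuous)).comp (IsOpenEmb.diffeo e.symm), fun p => ?_, ?_⟩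
  · refine (he (e.invSMap p)).symm.trans ?_
    rw [e.right_inv]
  · ext w
    constructor
    · rintro ⟨p, rfl⟩
      exact (e.invSMap p).2
    · intro hw
      exact ⟨e.toSMap ⟨w, hw⟩, congrArg (Subtype.val : (τ ⁻¹' U : Set W) → W) (e.left_inv ⟨w, hw⟩)⟩

theorem hasTangents_shadow (hτ : IsFibreBundle τ) (hs : (verticalProj π).comp s = τ)
    (χ : CurveJets W (shadowRel τ s)) : HasTangents χ := by
  obtain ⟨F, hF, h⟩ := hτ.locallyTrivial
  obtain ⟨U, hU, hx, e, he⟩ := h (τ (pt χ))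
  obtain ⟨j, hj, hτj, hr⟩ := exists_openEmb_of_trivialization hU e he
  exact hasTangents_local hs hU hj hτj (hasTangents_manifold hF) χ (hr.ge hx)

/-- Over `W` the fibre is to be a coordinate space, so `F` is shrunk to a chart `V`. The jets are
then `U × (jets in V) = (U × V) × ℝ^(ι × ℕ)`, with the free derivatives in the `F`-directions as
fibre coordinates. -/
theorem exists_local_bundle (hτ : IsFibreBundle τ) (hs : (verticalProj π).comp s = τ) :
    ∃ Fib : DiffSpace.{w}, IsSmoothManifold Fib ∧ Nonempty Fib ∧ ∀ w : W, ∃ (B : DiffSpace.{v})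
      (B' : DiffSpace.{v}) (k : SMap B W) (K : SMap B' (CurveJets W (shadowRel τ s))), IsOpenEmb k ∧
      IsOpenEmb K ∧ w ∈ range k.toFun ∧ range K.toFun = (proj W (shadowRel τ s)).toFun ⁻¹' range k.toFun ∧
      ∃ e : Diffeo B' (B.prod Fib), ∀ y, k (e.toSMap y).1 = proj W (shadowRel τ s) (K y) := by
  obtain ⟨F, hF, h⟩ := hτ.locallyTrivial
  obtain ⟨ι, _, hc⟩ := hF.charts
  refine ⟨coordU (ι × ℕ), isSmoothManifold_coordU _, ⟨⟨0⟩⟩, fun w => ?_⟩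
  obtain ⟨U, hU, hx, e, he⟩ := h (τ w)
  obtain ⟨j, hj, hτj, hr⟩ := exists_openEmb_of_trivialization hU e he
  obtain ⟨⟨a, y⟩, rfl⟩ : w ∈ range j.toFun := hr.ge hx
  obtain ⟨V, hV, i, hi, v, rfl⟩ := (hc y).exists_isOpenEmb
  have hk := hj.comp (hi.prod_right (X.sub U))
  have hτk : ∀ p, τ ((j.comp (pairS (fstS (X.sub U) ((coordSpace ι).sub V)) (i.comp (sndS _ _)))) p)
    = p.1.1 := fun p => hτj _
  obtain ⟨e₁, h₁⟩ := exists_diffeo_local hs hU hτk (hasTangents_open hV)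
  obtain ⟨e₂, h₂⟩ := exists_diffeo_coordU.{w} hV
  -- Reassociates the product, moving the base point in `V` out of the space of jets and into the
  -- base.
  let e₃ : Diffeo ((X.sub U).prod (CurveJets ((coordSpace ι).sub V) ∅))
      (((X.sub U).prod ((coordSpace ι).sub V)).prod (coordU.{w} (ι × ℕ))) :=
    ⟨pairS (pairS (fstS _ _) ((fstS _ _).comp (e₂.toSMap.comp (sndS _ _))))
      ((sndS _ _).comp (e₂.toSMap.comp (sndS _ _))),
      pairS ((fstS _ _).comp (fstS _ _))
        (e₂.invSMap.comp (pairS ((sndS _ _).comp (fstS _ _)) (sndS _ _))),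
      fun z => Prod.ext rfl (e₂.left_inv z.2),
      fun z => by
        have h := e₂.right_inv (z.1.2, z.2)
        exact Prod.ext (Prod.ext rfl (congrArg
          (Prod.fst : ((coordSpace ι).sub V) × coordU.{w} (ι × ℕ) → (coordSpace ι).sub V) h))
          (congrArg (Prod.snd : ((coordSpace ι).sub V) × coordU.{w} (ι × ℕ) → _) h)⟩
  refine ⟨_, _, _, map _ (mem_localRel hτk), hk, isOpenEmb_map hk _ (localRel_lift hτk),
    ⟨(a, v), rfl⟩, range_map hk _ (localRel_lift hτk), e₁.trans e₃, fun χ => ?_⟩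
  refine congrArg _ (Prod.ext (h₁ χ).1 ?_)
  exact (h₂ _).trans (h₁ χ).2

theorem isFibreBundle_proj (hτ : IsFibreBundle τ) (hs : (verticalProj π).comp s = τ) :
    IsFibreBundle (proj W (shadowRel τ s)) := by
  obtain ⟨Fib, hFib, ⟨c⟩, h⟩ := exists_local_bundle hτ hs
  refine ⟨fun w => ?_, Fib, hFib, fun w => ?_⟩
  · obtain ⟨B, B', k, K, hk, hK, ⟨b, rfl⟩, hr, e, he⟩ := h w
    exact ⟨K (e.invSMap (b, c)), (he _).symm.trans
      (congrArg (fun p : B.prod Fib => k p.1) (e.right_inv (b, c)))⟩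
  · obtain ⟨B, B', k, K, hk, hK, hw, hr, e, he⟩ := h w
    exact ⟨_, hk.isOpenMap.isOpen_range, hw, exists_trivialization hk hK hr e he⟩

/-- Local triviality of the composite is proved directly: a trivialization of `τ` over `U`, with the
whole fibre `F`, yields one with fibre the manifold of all jets of curves in `F`. -/
theorem isFibreBundle_comp (hτ : IsFibreBundle τ) (hs : (verticalProj π).comp s = τ) :
    IsFibreBundle (τ.comp (proj W (shadowRel τ s))) := by
  refine ⟨hτ.surjective.comp (isFibreBundle_proj hτ hs).surjective, ?_⟩
  obtain ⟨F, hF, h⟩ := hτ.locallyTrivial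
  refine ⟨CurveJets F ∅, isSmoothManifold hF, fun x => ?_⟩
  obtain ⟨U, hU, hx, e, he⟩ := h x
  obtain ⟨j, hj, hτj, hr⟩ := exists_openEmb_of_trivialization hU e he
  obtain ⟨e₁, h₁⟩ := exists_diffeo_local hs hU hτj (hasTangents_manifold hF)
  have hi := IsOpenEmb.inclusion hU
  refine ⟨_, hi.isOpenMap.isOpen_range, ⟨⟨x, hx⟩, rfl⟩, exists_trivialization hi
    (isOpenEmb_map hj (mem_localRel hτj) (localRel_lift hτj)) ?_ e₁ fun χ => ?_⟩
  · rw [range_map hj _ (localRel_lift hτj), hr]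
    ext χ
    change τ (pt χ) ∈ U ↔ τ (pt χ) ∈ range (Subtype.val : U → X)
    rw [Subtype.range_val]
  · exact (congrArg Subtype.val (h₁ χ).1).trans (hτj _).symm

/-! ### The connection on the space of jets and the symmetry -/

variable {CX : FlatConnection π} {CW : FlatConnection (π.comp τ)}

/-- The part of the shadow condition that makes the lifted connection compatible with the relations.
-/
theorem lift_pull_dFun (hs : IsShadow CX τ CW s) (Y : VectorField M) (f : SmoothFun X) :
    CW.lift Y (s.pull (dFun π f)) = s.pull (dFun π (CX.lift Y f)) :=
  Subtype.ext (funext fun w => (hs.preservesCartan Y w).on_differentials f)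

/-- The shadow has vertical values, so the derivative of a function from `M` along a jet vanishes.
This gives both `C^∞(M)`-linearity of the lifted connection and verticality of the time translation.
-/
theorem hom_const (χ : CurveJets W (shadowRel τ s)) (g : SmoothFun M) :
    hom χ ((π.comp τ).pull g) = PowerSeries.C (g (π (τ (pt χ)))) := by
  ext n
  cases n with
  | zero => 
    rw [coeff_zero_eq_constantCoeff_apply, centred χ,
      coeff_zero_eq_constantCoeff_apply, constantCoeff_C]
    rfl
  | succ n =>
    rw [coeff_succ_C]
    apply coeff_succ_eq_zero
    have h := rel χ _ ⟨π.pull g, rfl⟩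
    have h0 : s.pull (dFun π (π.pull g)) = 0 :=
      Subtype.ext (funext fun w => VerticalVector.vertical (s w) g)
    change d⁄dX ℝ (hom χ (τ.pull (π.pull g))) = hom χ (s.pull (dFun π (π.pull g))) at h
    rw [h0, map_zero] at h
    change coeff n (d⁄dX ℝ (hom χ (τ.pull (π.pull g)))) = 0
    rw [h, map_zero]

/-- `CW.lift Y` is applied to each Taylor coefficient, which amounts to composing the jet with this
derivation. All identities for the new connection are then inherited coefficientwise. -/
theorem exists_connection (hτ : IsCovering CX τ CW) (hs : IsShadow CX τ CW s) :
    ∃ C : FlatConnection ((π.comp τ).comp (proj W (shadowRel τ s))), ∀ Y n f,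
      C.lift Y (coeffFun n f) = coeffFun n (CW.lift Y f) := by
  have h : ∀ Y : VectorField M, ∃ D : VectorField (CurveJets W (shadowRel τ s)), ∀ n f,
      D (coeffFun n f) = coeffFun n (CW.lift Y f) := by
    intro Y
    refine exists_field (hasTangents_shadow hτ.bundle hs.lies_over)
      (fun χ => (hom χ).toLinearMap ∘ₗ (CW.lift Y).toLinearMap) (fun χ f g => ?_) ?_ _
      (fun n f χ => rfl)
    · change hom χ (CW.lift Y (f * g)) =
        hom χ f * hom χ (CW.lift Y g) + hom χ g * hom χ (CW.lift Y f)
      rw [Derivation.leibniz, map_add, smul_eq_mul, smul_eq_mul, map_mul, map_mul]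
    · rintro χ _ ⟨f, rfl⟩
      change d⁄dX ℝ (hom χ (CW.lift Y (τ.pull f))) = hom χ (CW.lift Y (s.pull (dFun π f)))
      -- The relation for `f` is carried to the relation for `CX.lift Y f`, which the jet satisfies
      -- as well.
      rw [hτ.compatible, lift_pull_dFun hs]
      exact rel χ _ ⟨CX.lift Y f, rfl⟩
  choose D hD using h
  refine ⟨⟨D, fun Y Z => ?_, fun g Y => ?_, fun Y g => ?_, fun Y Z => ?_⟩, hD⟩
  · refine field_ext fun n f => ?_
    rw [hD, CW.lift_add, Derivation.add_apply, Derivation.add_apply, hD, hD, coeffFun_add]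
  · refine field_ext fun n f => ?_
    rw [hD, CW.lift_smul, Derivation.smul_apply, Derivation.smul_apply, hD]
    refine Subtype.ext (funext fun χ => ?_)
    change coeff n (hom χ ((π.comp τ).pull g * CW.lift Y f)) =
      g (π (τ (pt χ))) * coeff n (hom χ (CW.lift Y f))
    -- Because the expansion of `g` is constant, multiplication by `g` does not mix coefficients of
    -- different orders.
    rw [map_mul, hom_const, coeff_C_mul]
  · have h1 : ∀ g, ((π.comp τ).comp (proj W (shadowRel τ s))).pull g =
        coeffFun 0 ((π.comp τ).pull g) := fun g =>
      proj_pull (R := shadowRel τ s) ((π.comp τ).pull g)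
    rw [h1, h1, hD, CW.lift_pull]
  · refine field_ext fun n f => ?_
    rw [hD, CW.flat, Derivation.commutator_apply, Derivation.commutator_apply, hD, hD, hD, hD,
      coeffFun_sub]

theorem exists_reconstruction (hτ : IsCovering CX τ CW) (hs : IsShadow CX τ CW s) :
    ∃ (W' : DiffSpace.{w}) (τ' : SMap W' W) (CW' : FlatConnection ((π.comp τ).comp τ')),
      IsCovering CW τ' CW' ∧ IsCovering CX (τ.comp τ') CW' ∧
      ∃ (S : VectorField W') (hS : IsNonlocalSymmetry CW' S)
        (s' : SMap W' (verticalTangent (π.comp (τ.comp τ')))),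
        s' = toSection ((π.comp τ).comp τ') S hS.vertical ∧
        PreservesCartan CW' CW' s' ∧
        (∀ w', verticalProj (π.comp (τ.comp τ')) (s' w') = w') ∧
        (verticalMap π (τ.comp τ')).comp s' = s.comp τ' := by
  obtain ⟨C, hC⟩ := exists_connection hτ hs
  obtain ⟨S, hS⟩ := exists_velocity (hasTangents_shadow (τ := τ) hτ.bundle hs.lies_over)
  -- On generators, one field shifts the order and the other acts on the argument, so they commute.
  have hcomm : ∀ Y f, S (C.lift Y f) = C.lift Y (S f) := by
    intro Y f
    have h : ⁅S, C.lift Y⁆ = 0 := field_ext fun n f => by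
      rw [Derivation.commutator_apply, hC, hS, hS, Derivation.map_smul, hC, sub_self]
      rfl
    have h1 := congrArg (fun D : VectorField _ => D f) h
    simp only [Derivation.commutator_apply] at h1
    exact sub_eq_zero.1 h1
  have hcov : ∀ (Y : VectorField M) (f : SmoothFun W), C.lift Y ((proj W (shadowRel τ s)).pull f) =
      (proj W (shadowRel τ s)).pull (CW.lift Y f) := by
    intro Y f
    rw [proj_pull, proj_pull, hC]
  have hsym : IsNonlocalSymmetry C S := by
    refine ⟨fun g => ?_, fun Z hZ => ?_⟩
    · have h1 : ((π.comp τ).comp (proj W (shadowRel τ s))).pull g =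
        coeffFun 0 ((π.comp τ).pull g) :=
        proj_pull (R := shadowRel τ s) ((π.comp τ).pull g)
      rw [h1, hS]
      refine Subtype.ext (funext fun χ => ?_)
      change _ * coeff (0 + 1) (hom χ ((π.comp τ).pull g)) = 0
      rw [hom_const, coeff_succ_C, mul_zero]
    · induction hZ using Submodule.span_induction with
      | mem Z h =>
        obtain ⟨Y, rfl⟩ := h
        have : ⁅S, C.lift Y⁆ = 0 := Derivation.ext fun f => by
          rw [Derivation.commutator_apply, hcomm, sub_self]
          rfl
        rw [this]
        exact Submodule.zero_mem _
      | zero =>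
        have : ⁅S, (0 : VectorField (CurveJets W (shadowRel τ s)))⁆ = 0 := Derivation.ext fun f => by
          rw [Derivation.commutator_apply]
          simp
        rw [this]
        exact Submodule.zero_mem _
      | add Z Z' _ _ h h' =>
        have : ⁅S, Z + Z'⁆ = ⁅S, Z⁆ + ⁅S, Z'⁆ := Derivation.ext fun f => by
          simp only [Derivation.commutator_apply, Derivation.add_apply, map_add]
          ring
        rw [this]
        exact Submodule.add_mem _ h h'
      | smul g Z hZ h =>
        -- The lifts commute with `S`, but the module they span does not: differentiating the
        -- coefficient produces `S g • Z`, which stays in the module.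
        have : ⁅S, g • Z⁆ = S g • Z + g • ⁅S, Z⁆ := Derivation.ext fun f => by
          simp only [Derivation.commutator_apply, Derivation.smul_apply, Derivation.add_apply,
            Derivation.leibniz, smul_eq_mul]
          ring
        rw [this]
        exact Submodule.add_mem _ (Submodule.smul_mem _ _ hZ) (Submodule.smul_mem _ _ h)
  refine ⟨CurveJets W (shadowRel τ s), proj _ _, C,
    ⟨isFibreBundle_proj hτ.bundle hs.lies_over, hcov⟩,
    ⟨isFibreBundle_comp hτ.bundle hs.lies_over, fun Y f => ?_⟩, S, hsym, _, rfl,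
    fun Y χ => ⟨fun f => rfl, fun f => ?_⟩, fun _ => rfl, ?_⟩
  · refine (hcov Y (τ.pull f)).trans ?_
    rw [hτ.compatible]
    rfl
  -- For a section given by a vertical field, the Cartan condition on differentials is exactly
  -- commutation with the lifts.
  · exact congrArg (fun g : SmoothFun _ => g χ) (hcomm Y f).symm
  -- The relation at order zero: the coefficient of order one of `τ.pull f` along a jet is the value
  -- of the shadow on `f` at its point.
  · have key : ∀ χ : CurveJets W (shadowRel τ s), ∀ f : SmoothFun X,
        S ((proj W (shadowRel τ s)).pull (τ.pull f)) χ = VerticalVector.vec (s (pt χ)) f := by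
      intro χ f
      rw [proj_pull, hS]
      have h := coeffFun_rel (R := shadowRel τ s) 0 ⟨f, rfl⟩
      rw [Nat.cast_zero] at h ⊢
      rw [← h, ← proj_pull]
      rfl
    refine SMap.ext (funext fun χ => ?_)
    have hp : VerticalVector.pt (s (pt χ)) = τ (pt χ) :=
      congrArg (fun F : SMap W X => F (pt χ)) hs.lies_over
    exact VerticalVector.ext_of_apply hp.symm (key χ)

end Reconstruction

end PDEGeom

end

theorem mainTheorem3 {n : ℕ} {M : Type u} [TopologicalSpace M]
    [ChartedSpace (EuclideanSpace ℝ (Fin n)) M] [IsManifold (𝓡 n) ∞ M] [T2Space M]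
    [SecondCountableTopology M]
    {F : Type*} [NormedAddCommGroup F] [NormedSpace ℝ F] [FiniteDimensional ℝ F]
    {V : M → Type v} [∀ x, AddCommGroup (V x)] [∀ x, Module ℝ (V x)]
    [TopologicalSpace (Bundle.TotalSpace F V)] [∀ x, TopologicalSpace (V x)] [FiberBundle F V]
    [VectorBundle ℝ F V] [ContMDiffVectorBundle ∞ F V (𝓡 n)]
    {k : ℕ} (E : Set (JetSpace (bundleProjection (n := n) F V) k)) (hE : FormallyIntegrable E)
    {W : DiffSpace.{w}} (τ : SMap W (EInf E)) (CW : FlatConnection ((projE E).comp τ))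
    (hτ : IsCovering (cartan hE) τ CW)
    (s : SMap W (verticalTangent (projE E))) (hs : IsShadow (cartan hE) τ CW s) :
    ∃ (W' : DiffSpace.{w}) (τ' : SMap W' W) (CW' : FlatConnection (((projE E).comp τ).comp τ')),
      IsCovering CW τ' CW' ∧ IsCovering (cartan hE) (τ.comp τ') CW' ∧
      ∃ (S : VectorField W') (hS : IsNonlocalSymmetry CW' S)
        (s' : SMap W' (verticalTangent ((projE E).comp (τ.comp τ')))),
        s' = toSection (((projE E).comp τ).comp τ') S hS.vertical ∧
        PreservesCartan CW' CW' s' ∧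
        (∀ w', verticalProj ((projE E).comp (τ.comp τ')) (s' w') = w') ∧
        (verticalMap (projE E) (τ.comp τ')).comp s' = s.comp τ' := by
  exact exists_reconstruction hτ hs
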